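/- **Setting.** All particle numbers $n$ and the integer $m\ge 0$ are even; $r\ge 0$ with $2r\le m$; $0\le s\le m/2$ and $0\le k_1,\dots,k_r\le m$ are integers; $\pm$ is a fixed sign. $V=\mathbb C v_+\oplus\mathbb C v_-$, $A_a=e^{-\alpha_a}$, $B_j=e^{-\beta_j}$, and for $n\ge m$ put $\ell_n=r+\frac{n-m}2$. Let $$\zeta(\beta)=\frac{\Gamma_2(-i\beta+3\pi)\Gamma_2(i\beta+\pi)}{\Gamma_2(-i\beta+2\pi)\Gamma_2(i\beta)},\qquad \Gamma_2(x)=\Gamma_2(x|2\pi,2\pi)\ \text{(double gamma function)},$$ $$\phi(\alpha)=\prod_{j=1}^n\frac{\Gamma(\frac{\alpha-\beta_j+\pi i}{-2\pi i})}{\Gamma(\frac{\alpha-\beta_j}{-2\pi i})}.$$ For $M=\{m_1<\dots<m_\ell\}\subset\{1,\dots,n\}$ let $v_M=v_{\epsilon_1}\otimes\cdots\otimes v_{\epsilon_n}$ with $M=\{i:\epsilon_i=-\}$, and let $w_M$ be the antisymmetrisation $\sum_{\sigma\in S_\ell}\mathrm{sgn}(\sigma)\,g_M(\alpha_{\sigma(1)},\dots,\alpha_{\sigma(\ell)})$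 of $$g_M=\prod_{a=1}^\ell\Bigl(\frac1{\alpha_a-\beta_{m_a}}\prod_{j<m_a}\frac{\alpha_a-\beta_j+\pi i}{\alpha_a-\beta_j}\Bigr)\prod_{a<b}(\alpha_a-\alpha_b+\pi i).$$ For a function $P(A_1,\dots,A_\ell|B_1,\dots,B_n)$ (a "cycle") put $$f_P(\beta_1,\dots,\beta_n)=e^{\frac n4\sum_j\beta_j}\prod_{j<j'}\zeta(\beta_j-\beta_{j'})\sum_{\sharp M=\ell}v_M\int_{C^\ell}\prod_a d\alpha_a\,\phi(\alpha_a)\;w_M\,\frac{P}{\prod_{a,j}(1-A_aB_j^{-1})},$$ for $\beta\in\mathbb C^n$ with $\beta_i-\beta_j\notin\pi i(2\mathbb Z+1)$ for all $i,j$, where $C$ is a simple $C^1$ curve going from $-\infty$ to $\infty$, along horizontal rays near both ends, which lies below the points $\beta_j-\pi i+2\pi i k$ and above the points $\beta_j-2\pi ik$ ($k\ge0$, $1\le j\le n$). Let $P_n=0$ for $n<m$, and for $n\ge m$, with all deformation parameters $t_k$ equal to $0$, $$P_{n(\pm)}=c_n\Bigl(\prod_{j=1}^nB_j\Bigr)^s\prod_{a=1}^rA_a^{k_a}\prod_{a=r+1}^{\ell_n}A_a^{\,n+1-2s+2r-2a}\;D_n^{\pm},$$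 $$c_n=(-1)^{\frac12(n-m)s+\frac12m(m-1)}\Bigl(\frac{-2\pi}{\zeta(-\pi i)}\Bigr)^{\frac{n-m}2}(-2\pi i)^{\frac{(m-n)(2n+2r-m)}4},$$ where $D_n^\pm$ is one of the following. * *Determinant cycles*: $D_n^\pm$ is $\prod_{j<j'}(B_j^{\pm1}-B_{j'}^{\pm1})^{-1}$ times the determinant of the $n\times n$ matrix whose $j$-th column consists of $B_j^{\pm 2i}$ for $0\le i<\frac{n+m}2$, followed by $B_j^{\pm(2p-1)}\prod_{a=1}^r(1-A_a^2B_j^{-2})$ for $1\le p\le\frac{n-m}2$. * *Exponential cycles* (only for $r=0$): $D_n^{\pm}=(-1)^{\frac18(n-m)(n-m+2)}$. **Proposition.** In both cases, for every even $n$, the integrals above converge absolutely and do not depend on the choice of $C$, so that the form factors $f_{P_{n(\pm)}}$ are well defined, and the local operator with these form factors has spin $S$: for all even $n$, all $\beta$ as above and all $\theta\in\mathbb C$, $$f_{P_{n(\pm)}}(\beta_1+\theta,\dots,\beta_n+\theta)=e^{\theta S}f_{P_{n(\pm)}}(\beta_1,\dots,\beta_n),$$ where $$S=S^\pm_{s,m}(k_1,\dots,k_r)=-\sum_{a=1}^rk_a+\frac{m^2}4-ms\mp\frac{m(m-1)}2$$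 for the determinant cycles, and $S=\frac{m^2}4-ms$ for the exponential cycles. -/

import Mathlib

noncomputable section

namespace SU2Thirring

open Complex Filter MeasureTheory

/-! Double gamma function and the scalar function `ζ` -/

/-- The Barnes `G`-function, by its Weierstrass product
`G(1+w) = (2π)^{w/2} exp(-(w + w²(1+γ))/2) ∏_{k≥1} (1 + w/k)^k exp(w²/(2k) - w)`. -/
def barnesG (z : ℂ) : ℂ :=
  (2 * (Real.pi : ℂ)) ^ ((z - 1) / 2) *
    exp (-((z - 1) + (z - 1) ^ 2 * (1 + (Real.eulerMascheroniConstant : ℂ))) / 2) *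
    ∏' k : ℕ, ((1 + (z - 1) / ((k : ℂ) + 1)) ^ (k + 1) *
      exp ((z - 1) ^ 2 / (2 * ((k : ℂ) + 1)) - (z - 1)))

/-- The double gamma function `Γ₂(x | ω, ω)` with equal periods `ω > 0`, normalised as
`exp (∂ₛ ζ₂(s, x | ω, ω))` at `s = 0`. It satisfies
`Γ₂(x + ω) / Γ₂(x) = √(2π) ω^{1/2 - x/ω} / Γ(x/ω)`, and `1 / Γ₂` is entire with zeros exactly at
`x ∈ ω ℤ_{≤ 0}`. (At these poles of `Γ₂` the Lean value is `0`.) -/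
def doubleGamma (ω : ℝ) (x : ℂ) : ℂ :=
  exp (deriv riemannZeta (-1)) * (2 * (Real.pi : ℂ)) ^ ((x / ω - 1) / 2) *
    (ω : ℂ) ^ (-(x ^ 2 / (2 * (ω : ℂ) ^ 2) - x / ω + 5 / 12)) / barnesG (x / ω)

/-- `Γ₂(x) = Γ₂(x | 2π, 2π)`. -/
def Gamma₂ (x : ℂ) : ℂ := doubleGamma (2 * Real.pi) x

/-- `ζ(β) = Γ₂(-iβ + 3π) Γ₂(iβ + π) / (Γ₂(-iβ + 2π) Γ₂(iβ))`. Its zeros are the points of `2πiℤ`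
(where the Lean value is `0`, too) and its poles lie in `πi(2ℤ + 1)`. -/
def zetaFn (β : ℂ) : ℂ :=
  Gamma₂ (-I * β + 3 * Real.pi) * Gamma₂ (I * β + Real.pi) /
    (Gamma₂ (-I * β + 2 * Real.pi) * Gamma₂ (I * β))

/-! The space of states -/

/-- `V^{⊗ n}` with `V = ℂ v₊ ⊕ ℂ v₋`. -/
abbrev TensorSpace (n : ℕ) : Type := PiTensorProduct ℂ (fun _ : Fin n => Fin 2 → ℂ)

def vPlus : Fin 2 → ℂ := ![1, 0]

def vMinus : Fin 2 → ℂ := ![0, 1]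

/-- `v_M = v_{ε₁} ⊗ ⋯ ⊗ v_{εₙ}` with `M = {i | εᵢ = -}`. -/
def vM {n : ℕ} (M : Finset (Fin n)) : TensorSpace n :=
  PiTensorProduct.tprod ℂ (fun i : Fin n => if i ∈ M then vMinus else vPlus)

/-! The integrand -/

/-- `φ(α) = ∏ⱼ Γ((α - βⱼ + πi)/(-2πi)) / Γ((α - βⱼ)/(-2πi))`. -/
def phi {n : ℕ} (β : Fin n → ℂ) (α : ℂ) : ℂ :=
  ∏ j, Gamma ((α - β j + Real.pi * I) / (-2 * Real.pi * I)) /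
    Gamma ((α - β j) / (-2 * Real.pi * I))

/-- `g_M(α₁, …, α_ℓ)` for `M = {m₁ < ⋯ < m_ℓ}`. -/
def gM {n ℓ : ℕ} (β : Fin n → ℂ) (M : Finset (Fin n)) (hM : M.card = ℓ) (α : Fin ℓ → ℂ) : ℂ :=
  (∏ a, (1 / (α a - β (M.orderEmbOfFin hM a)) *
    ∏ j ∈ Finset.Iio (M.orderEmbOfFin hM a), (α a - β j + Real.pi * I) / (α a - β j))) *
  ∏ a, ∏ b ∈ Finset.Ioi a, (α a - α b + Real.pi * I)

/-- The antisymmetrisation of a function of `α₁, …, α_ℓ`. -/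
def asym {ℓ : ℕ} (f : (Fin ℓ → ℂ) → ℂ) (α : Fin ℓ → ℂ) : ℂ :=
  ∑ σ : Equiv.Perm (Fin ℓ), ((Equiv.Perm.sign σ : ℤ) : ℂ) * f (fun a => α (σ a))

/-- `w_M = Asym g_M`. -/
def wM {n ℓ : ℕ} (β : Fin n → ℂ) (M : Finset (Fin n)) (hM : M.card = ℓ) (α : Fin ℓ → ℂ) : ℂ :=
  asym (gM β M hM) α

/-- The `n`-tuple `Bⱼ = exp(-βⱼ)`, and likewise `A_a = exp(-α_a)`. -/
def expNeg {n : ℕ} (β : Fin n → ℂ) : Fin n → ℂ := fun j => exp (-β j)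

/-- The function `W = P(A|B) / ∏_{a,j} (1 - A_a Bⱼ⁻¹)`. -/
def cycleFn {n ℓ : ℕ} (P : (Fin ℓ → ℂ) → (Fin n → ℂ) → ℂ) (β : Fin n → ℂ) (α : Fin ℓ → ℂ) : ℂ :=
  P (expNeg α) (expNeg β) / ∏ a, ∏ j, (1 - expNeg α a * (expNeg β j)⁻¹)

/-- The integrand `∏_a φ(α_a) w_M W`. -/
def integrand {n ℓ : ℕ} (P : (Fin ℓ → ℂ) → (Fin n → ℂ) → ℂ) (β : Fin n → ℂ)
    (M : Finset (Fin n)) (hM : M.card = ℓ) (α : Fin ℓ → ℂ) : ℂ :=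
  (∏ a, phi β (α a)) * wM β M hM α * cycleFn P β α

/-! The contour -/

/-- `γ` parametrises a contour `C` for `β`: a simple `C¹` curve going from `-∞` to `∞` (along
horizontal rays near both ends) which separates the points `βⱼ - πi - 2πiℤ_{≤ 0}`, lying above it,
from the points `βⱼ - 2πiℤ_{≥ 0}`, lying below it. A point lies above (below) the curve if it can be
joined in the complement of the curve to `iy` for all large positive (negative) `y`. -/
structure IsContour {n : ℕ} (β : Fin n → ℂ) (γ : ℝ → ℂ) : Prop where
  contDiff : ContDiff ℝ 1 γ
  injective : Function.Injective γ
  right_end : ∃ c : ℂ, ∀ᶠ t : ℝ in atTop, γ t = (t : ℂ) + c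
  left_end : ∃ c : ℂ, ∀ᶠ t : ℝ in atBot, γ t = (t : ℂ) + c
  above : ∀ (j : Fin n) (k : ℕ), ∀ᶠ y : ℝ in atTop,
    JoinedIn (Set.range γ)ᶜ (β j - Real.pi * I + 2 * Real.pi * I * k) ((y : ℂ) * I)
  below : ∀ (j : Fin n) (k : ℕ), ∀ᶠ y : ℝ in atBot,
    JoinedIn (Set.range γ)ᶜ (β j - 2 * Real.pi * I * k) ((y : ℂ) * I)

/-- The function on `ℝ^ℓ` whose integral is `∫_{C^ℓ} ∏_a dα_a F(α₁, …, α_ℓ)`. -/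
def pullback {ℓ : ℕ} (γ : ℝ → ℂ) (F : (Fin ℓ → ℂ) → ℂ) (t : Fin ℓ → ℝ) : ℂ :=
  (∏ a, deriv γ (t a)) * F (fun a => γ (t a))

/-- `Ψ_P(β₁, …, βₙ)`, computed with the contour `γ`. -/
def PsiAlong {n ℓ : ℕ} (P : (Fin ℓ → ℂ) → (Fin n → ℂ) → ℂ) (β : Fin n → ℂ) (γ : ℝ → ℂ) :
    TensorSpace n :=
  ∑ M : {M : Finset (Fin n) // M.card = ℓ},
    (∫ t : Fin ℓ → ℝ, pullback γ (integrand P β M.1 M.2) t) • vM M.1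

/-- `f_P = exp((n/4) ∑ⱼ βⱼ) ∏_{j<j'} ζ(βⱼ - βⱼ') Ψ_P`, computed with the contour `γ`. -/
def formFactorAlong {n ℓ : ℕ} (P : (Fin ℓ → ℂ) → (Fin n → ℂ) → ℂ) (β : Fin n → ℂ) (γ : ℝ → ℂ) :
    TensorSpace n :=
  (exp ((n : ℂ) / 4 * ∑ j, β j) * ∏ j, ∏ j' ∈ Finset.Ioi j, zetaFn (β j - β j')) • PsiAlong P β γ

open scoped Classical in
/-- `f_P(β₁, …, βₙ)`, computed with an arbitrarily chosen contour for `β`. -/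
def formFactor {n ℓ : ℕ} (P : (Fin ℓ → ℂ) → (Fin n → ℂ) → ℂ) (β : Fin n → ℂ) : TensorSpace n :=
  if h : ∃ γ : ℝ → ℂ, IsContour β γ then formFactorAlong P β h.choose else 0

/-- The domain of definition of the form factors: the points `β` with
`βᵢ - βⱼ ∉ πi(2ℤ + 1)` for all `i`, `j`. -/
def regularPoints (n : ℕ) : Set (Fin n → ℂ) :=
  {β | ∀ (i j : Fin n) (p : ℤ), β i - β j ≠ (2 * (p : ℂ) + 1) * Real.pi * I}

/-! The cycles of the minimal form factors. The sign `±` is `ε : ℤˣ`. -/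

/-- `E_n(t|B) = exp(∑ₖ tₖ ∑ⱼ Bⱼᵏ)`. -/
def En {n : ℕ} (t : ℤ → ℂ) (B : Fin n → ℂ) : ℂ := exp (∑' k : ℤ, t k * ∑ j, B j ^ k)

/-- The constant `c_n^{m,r,s}`; for even `n ≥ m` and even `m` all its exponents are integers. -/
def cConst (n m r s : ℕ) : ℂ :=
  (-1) ^ ((n - m) / 2 * s + m * (m - 1) / 2) *
    (-2 * Real.pi / zetaFn (-Real.pi * I)) ^ ((n - m) / 2) *
    (-2 * Real.pi * I) ^ ((((m : ℤ) - n) * (2 * n + 2 * r - m)) / 4)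

/-- `H_p^±(B)`. -/
def Hp {r : ℕ} (ε : ℤˣ) (t : ℤ → ℂ) (A : Fin r → ℂ) (p : ℕ) (b : ℂ) : ℂ :=
  exp (-2 * ∑' k : ℤ, t (2 * k) * b ^ (2 * k)) * b ^ ((ε : ℤ) * (2 * (p : ℤ) - 1)) *
    ∏ a, (1 - A a ^ 2 * b ^ (-2 : ℤ))

/-- `D_n^±(A₁, …, A_r | B₁, …, Bₙ)` as a quotient of determinants. The rows of the numerator are
`Bⱼ^{±2i}`, `0 ≤ i < (n+m)/2`, and then `H_p^±(Bⱼ)`, `1 ≤ p ≤ (n-m)/2`. -/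
def Ddet {r n : ℕ} (ε : ℤˣ) (m : ℕ) (t : ℤ → ℂ) (A : Fin r → ℂ) (B : Fin n → ℂ) : ℂ :=
  (Matrix.of (fun i j : Fin n =>
      if (i : ℕ) < (n + m) / 2 then B j ^ ((ε : ℤ) * (2 * ((i : ℕ) : ℤ)))
      else Hp ε t A ((i : ℕ) - (n + m) / 2 + 1) (B j))).det /
    ∏ j, ∏ j' ∈ Finset.Ioi j, (B j ^ (ε : ℤ) - B j' ^ (ε : ℤ))

/-- The exponential factor `D_n(B₁, …, Bₙ)` available for `r = 0`. -/
def Dexp {n : ℕ} (m : ℕ) (t : ℤ → ℂ) (B : Fin n → ℂ) : ℂ :=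
  (-1) ^ ((n - m) * (n - m + 2) / 8) * exp (-∑' k : ℤ, t (2 * k) * ∑ j, B j ^ (2 * k))

/-- The common factor
`c_n E_n(t|B) (∏ⱼ Bⱼ)^s ∏_{a ≤ r} A_a^{k_a} ∏_{r < a ≤ ℓ_n} A_a^{n+1-2s+2r-2a}`,
with `ℓ_n = r + (n-m)/2`. -/
def cyclePrefactor (m r s : ℕ) (k : Fin r → ℕ) (t : ℤ → ℂ) (n : ℕ)
    (A : Fin (r + (n - m) / 2) → ℂ) (B : Fin n → ℂ) : ℂ :=
  cConst n m r s * En t B * (∏ j, B j) ^ s *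
    (∏ a : Fin r, A (Fin.castAdd _ a) ^ k a) *
    ∏ b : Fin ((n - m) / 2),
      A (Fin.natAdd r b) ^ ((n : ℤ) + 1 - 2 * s + 2 * r - 2 * ((r : ℤ) + ((b : ℕ) : ℤ) + 1))

/-- The determinant cycles `P_{n(±)}`, with `P_n = 0` for `n < m`. -/
def detCycle (ε : ℤˣ) (m r s : ℕ) (k : Fin r → ℕ) (t : ℤ → ℂ) (n : ℕ)
    (A : Fin (r + (n - m) / 2) → ℂ) (B : Fin n → ℂ) : ℂ :=
  if n < m then 0
  else cyclePrefactor m r s k t n A B * Ddet ε m t (fun a : Fin r => A (Fin.castAdd _ a)) B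

/-- The exponential cycles `P_n` for `r = 0`, with `P_n = 0` for `n < m`. -/
def expCycle (m s : ℕ) (t : ℤ → ℂ) (n : ℕ)
    (A : Fin (0 + (n - m) / 2) → ℂ) (B : Fin n → ℂ) : ℂ :=
  if n < m then 0 else cyclePrefactor m 0 s ![] t n A B * Dexp m t B

/-! Spin -/

/-- The family `f` of form factors (one for each even particle number `n`) has spin `S`:
`f(β₁ + θ, …, βₙ + θ) = exp(θ S) f(β₁, …, βₙ)`. -/
def HasSpin (f : ∀ n : ℕ, (Fin n → ℂ) → TensorSpace n) (S : ℂ) : Prop :=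
  ∀ n : ℕ, Even n → ∀ β ∈ regularPoints n, ∀ θ : ℂ,
    f n (fun j => β j + θ) = exp (θ * S) • f n β

/-- The integrals defining the form factors of the family `P` converge absolutely for every contour,
and the form factors do not depend on the contour. -/
def WellDefined {ℓ : ℕ → ℕ} (P : ∀ n : ℕ, (Fin (ℓ n) → ℂ) → (Fin n → ℂ) → ℂ) : Prop :=
  ∀ n : ℕ, Even n → ∀ β ∈ regularPoints n, ∀ γ : ℝ → ℂ, IsContour β γ →
    (∀ (M : Finset (Fin n)) (hM : M.card = ℓ n),
      Integrable (pullback γ (integrand (P n) β M hM))) ∧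
    formFactor (P n) β = formFactorAlong (P n) β γ

end SU2Thirring

end

noncomputable section

namespace SU2Thirring

open Complex Filter MeasureTheory

open Asymptotics

open scoped Topology

/-! The spin is a matter of homogeneity. Under a common translation by `θ` of all `β_j`, translate
the contour as well: `φ`, `w_M`, the `ζ` factors and the quotients `A_a/B_j` depend on differences
only. What changes is the exponential prefactor, contributing `n²/4`, and the cycle, homogeneous in
`(A, B)`. Its degree is `ms + ∑ k_a + (n² - m²)/4`, plus `±m(m-1)/2` from the determinant quotient,
so the dependence on `n` cancels (`formFactorAlong_shift`, `cyclePrefactor_smul`, `Ddet_smul`).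

To use the translated contour, convergence and independence of the contour are needed. At fixed `B`
the cycle is a polynomial in the `A_a` of degree at most `n` in each. Expanding it and the
polynomial part of `w_M` into monomials reduces everything to products of one-variable integrals.
There `φ` decays like `|α|^{-n/2}`, the rational factor like `|α|^{-1}`, the power of `α` is at most
`ℓ - 1 ≤ n/2 - 1`, and the exponential quotient is bounded. The total `O(|α|^{-2})` is integrable
(`isBigO_oneVar`).

Independence is a residue-free form of Cauchy's theorem in a strip. A point's side is detected by
truncated integrals of `1/(z - p)`, which are locally constant in `p` in the limit. A meromorphic
integrand is split into principal parts, on which the two curves agree, and a holomorphic remainder,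
which has a primitive (`StripMero.loopNull`). The reflection formula shows that the only poles are
those which the contour separates. -/

/-! ### Curves with horizontal ends and the side on which a point lies. -/

/-- A `C¹` curve going from `-∞` to `∞`, along horizontal rays near both ends. -/
structure HorizontalEnds (γ : ℝ → ℂ) : Prop where
  contDiff : ContDiff ℝ 1 γ
  right_end : ∃ c : ℂ, ∀ᶠ t : ℝ in atTop, γ t = (t : ℂ) + c
  left_end : ∃ c : ℂ, ∀ᶠ t : ℝ in atBot, γ t = (t : ℂ) + c

lemma IsContour.horizontalEnds {n : ℕ} {β : Fin n → ℂ} {γ : ℝ → ℂ} (h : IsContour β γ) :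
    HorizontalEnds γ :=
  ⟨h.contDiff, h.right_end, h.left_end⟩

/-- The open horizontal strip `|Im z| < Y`. -/
def strip (Y : ℝ) : Set ℂ := {z | |z.im| < Y}

lemma isOpen_strip (Y : ℝ) : IsOpen (strip Y) :=
  isOpen_lt (by fun_prop) continuous_const

lemma convex_strip (Y : ℝ) : Convex ℝ (strip Y) := by
  have : strip Y = {z : ℂ | -Y < z.im} ∩ {z : ℂ | z.im < Y} := by
    ext z; simp [strip, abs_lt]
  rw [this]
  exact (convex_halfSpace_im_gt _).inter (convex_halfSpace_im_lt _)

/-- The filter of points of a horizontal strip going to infinity. -/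
def stripEnds (Y : ℝ) : Filter ℂ := comap (fun z : ℂ => |z.re|) atTop ⊓ 𝓟 (strip Y)

lemma stripEnds_le_cobounded (Y : ℝ) : stripEnds Y ≤ Bornology.cobounded ℂ := by
  refine inf_le_left.trans ?_
  rw [← comap_norm_atTop, ← tendsto_iff_comap]
  exact tendsto_atTop_mono (fun z => abs_re_le_norm z) tendsto_comap

lemma eventually_stripEnds {Y : ℝ} {p : ℂ → Prop} :
    (∀ᶠ z in stripEnds Y, p z) ↔ ∃ R : ℝ, ∀ z : ℂ, |z.im| < Y → R ≤ |z.re| → p z := by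
  rw [stripEnds, eventually_inf_principal, eventually_comap]
  constructor
  · intro h
    obtain ⟨R, hR⟩ := eventually_atTop.1 h
    exact ⟨R, fun z hz hR' => hR _ hR' z rfl hz⟩
  · rintro ⟨R, hR⟩
    filter_upwards [eventually_ge_atTop R] with x hx z hz hz'
    exact hR z hz' (hz ▸ hx)

namespace HorizontalEnds

variable {γ : ℝ → ℂ} (h : HorizontalEnds γ)
include h

lemma continuous : Continuous γ := h.contDiff.continuous

lemma continuous_deriv : Continuous (deriv γ) := h.contDiff.continuous_deriv le_rfl

lemma hasDerivAt (t : ℝ) : HasDerivAt γ (deriv γ t) t :=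
  (h.contDiff.differentiable (by norm_num) t).hasDerivAt

lemma exists_strip : ∃ Y : ℝ, 0 < Y ∧ ∀ t, γ t ∈ strip Y := by
  obtain ⟨c, hc⟩ := h.right_end
  obtain ⟨c', hc'⟩ := h.left_end
  obtain ⟨T, hT⟩ := eventually_atTop.1 hc
  obtain ⟨T', hT'⟩ := eventually_atBot.1 hc'
  obtain ⟨M, hM⟩ := (isCompact_Icc (a := T') (b := T)).exists_bound_of_continuousOn
    h.continuous.continuousOn
  refine ⟨max |M| (max |c.im| |c'.im|) + 1, by positivity, fun t => ?_⟩
  rw [strip, Set.mem_ofPred_eq, ← sub_pos]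
  have h1 := le_max_left |M| (max |c.im| |c'.im|)
  have h2 := le_max_right |M| (max |c.im| |c'.im|)
  have h3 := le_max_left |c.im| |c'.im|
  have h4 := le_max_right |c.im| |c'.im|
  rcases le_total T t with ht | ht
  · rw [hT t ht]; simp; linarith
  rcases le_total t T' with ht' | ht'
  · rw [hT' t ht']; simp; linarith
  · have := (abs_im_le_norm (γ t)).trans (hM t ⟨ht', ht⟩)
    have := le_abs_self M
    linarith

lemma tendsto_stripEnds_right {Y : ℝ} (hY : ∀ t, γ t ∈ strip Y) :
    Tendsto γ atTop (stripEnds Y) := by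
  obtain ⟨c, hc⟩ := h.right_end
  refine tendsto_inf.2 ⟨tendsto_comap_iff.2 ?_, tendsto_principal.2 (Eventually.of_forall hY)⟩
  refine tendsto_abs_atTop_atTop.comp ((tendsto_atTop_add_const_right _ c.re tendsto_id).congr' ?_)
  filter_upwards [hc] with t ht
  simp [ht]

lemma tendsto_stripEnds_left {Y : ℝ} (hY : ∀ t, γ t ∈ strip Y) :
    Tendsto γ atBot (stripEnds Y) := by
  obtain ⟨c, hc⟩ := h.left_end
  refine tendsto_inf.2 ⟨tendsto_comap_iff.2 ?_, tendsto_principal.2 (Eventually.of_forall hY)⟩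
  refine tendsto_abs_atBot_atTop.comp ((tendsto_atBot_add_const_right _ c.re tendsto_id).congr' ?_)
  filter_upwards [hc] with t ht
  simp [ht]

lemma tendsto_cobounded_right : Tendsto γ atTop (Bornology.cobounded ℂ) := by
  obtain ⟨Y, -, hY⟩ := h.exists_strip
  exact (h.tendsto_stripEnds_right hY).mono_right (stripEnds_le_cobounded Y)

lemma tendsto_cobounded_left : Tendsto γ atBot (Bornology.cobounded ℂ) := by
  obtain ⟨Y, -, hY⟩ := h.exists_strip
  exact (h.tendsto_stripEnds_left hY).mono_right (stripEnds_le_cobounded Y)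

/-- The curve is a proper map, since it leaves every bounded set at both ends. Closedness gives
every point off the curve a disc that misses it. -/
lemma isClosed_range : IsClosed (Set.range γ) := by
  refine (isProperMap_iff_tendsto_cocompact.2 ⟨h.continuous, ?_⟩).isClosedMap.isClosed_range
  rw [← Metric.cobounded_eq_cocompact (α := ℂ), cocompact_eq_atBot_atTop]
  exact tendsto_sup.2 ⟨h.tendsto_cobounded_left, h.tendsto_cobounded_right⟩

lemma tendsto_div_right (a : ℂ) : Tendsto (fun R : ℝ => (γ R - a) / R) atTop (𝓝 1) := by
  obtain ⟨c, hc⟩ := h.right_end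
  have h1 : Tendsto (fun R : ℝ => 1 + (c - a) * ((R⁻¹ : ℝ) : ℂ)) atTop (𝓝 (1 + (c - a) * 0)) :=
    tendsto_const_nhds.add (tendsto_const_nhds.mul
      ((continuous_ofReal.tendsto' 0 0 ofReal_zero).comp tendsto_inv_atTop_zero))
  rw [mul_zero, add_zero] at h1
  refine h1.congr' ?_
  filter_upwards [hc, eventually_gt_atTop 0] with R hR hR0
  have : (R : ℂ) ≠ 0 := by exact_mod_cast hR0.ne'
  rw [hR]; push_cast; field_simp; ring

lemma tendsto_div_left (a : ℂ) : Tendsto (fun R : ℝ => (γ (-R) - a) / R) atTop (𝓝 (-1)) := by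
  obtain ⟨c, hc⟩ := h.left_end
  have h1 : Tendsto (fun R : ℝ => -1 + (c - a) * ((R⁻¹ : ℝ) : ℂ)) atTop (𝓝 (-1 + (c - a) * 0)) :=
    tendsto_const_nhds.add (tendsto_const_nhds.mul
      ((continuous_ofReal.tendsto' 0 0 ofReal_zero).comp tendsto_inv_atTop_zero))
  rw [mul_zero, add_zero] at h1
  refine h1.congr' ?_
  filter_upwards [tendsto_neg_atTop_atBot.eventually hc, eventually_gt_atTop 0] with R hR hR0
  have : (R : ℂ) ≠ 0 := by exact_mod_cast hR0.ne'
  rw [hR]; push_cast; field_simp; ring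

lemma integral_eq_sub {U : Set ℂ} (hU : ∀ t, γ t ∈ U) {F f : ℂ → ℂ}
    (hF : ∀ z ∈ U, HasDerivAt F (f z) z) (hf : ContinuousOn f U) (a b : ℝ) :
    ∫ t in a..b, deriv γ t * f (γ t) = F (γ b) - F (γ a) := by
  refine intervalIntegral.integral_eq_sub_of_hasDerivAt (f := fun t => F (γ t)) (fun t _ => ?_)
    (Continuous.intervalIntegrable ?_ _ _)
  · simpa [Function.comp_def] using (hF _ (hU t)).scomp t (h.hasDerivAt t)
  · exact h.continuous_deriv.mul (hf.comp_continuous h.continuous hU)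

lemma intervalIntegrable {f : ℝ → ℂ} (hf : Continuous f) (a b : ℝ) :
    IntervalIntegrable (fun t => deriv γ t * f t) volume a b :=
  (h.continuous_deriv.mul hf).intervalIntegrable _ _

/-- Truncated integrals of `1/(z - p)` and `1/(z - q)` along a curve agree in the limit if `p` and
`q` can be joined in the complement of the curve. -/
lemma tendsto_integral_inv_sub_of_joinedIn {p q : ℂ} (hpq : JoinedIn (Set.range γ)ᶜ p q) :
    Tendsto (fun R : ℝ => (∫ t in -R..R, deriv γ t * (γ t - p)⁻¹) -
      ∫ t in -R..R, deriv γ t * (γ t - q)⁻¹) atTop (𝓝 0) := by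
  obtain ⟨w, hw⟩ := hpq
  -- Having the same limiting integral is an equivalence relation. On the connected image of the
  -- path it is enough to relate each point to its neighbours.
  refine (isPreconnected_range w.continuous).induction₂
    (fun p q => Tendsto (fun R : ℝ => (∫ t in -R..R, deriv γ t * (γ t - p)⁻¹) -
      ∫ t in -R..R, deriv γ t * (γ t - q)⁻¹) atTop (𝓝 0)) ?_ ?_ ?_ ⟨0, w.source⟩ ⟨1, w.target⟩
  · rintro _ ⟨t₀, rfl⟩
    refine mem_nhdsWithin_of_mem_nhds ?_
    obtain ⟨r, hr, hball⟩ := Metric.isOpen_iff.1 h.isClosed_range.isOpen_compl _ (hw t₀)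
    filter_upwards [Metric.ball_mem_nhds _ hr] with y hy
    set x := w t₀
    have hx : ∀ t, r ≤ ‖γ t - x‖ := fun t => by
      by_contra! hlt
      exact hball (mem_ball_iff_norm.2 hlt) ⟨t, rfl⟩
    have hyx : ‖y - x‖ < r := mem_ball_iff_norm.1 hy
    have hx0 : ∀ t, γ t - x ≠ 0 := fun t => norm_pos_iff.1 (hr.trans_le (hx t))
    have hy0 : ∀ t, γ t - y ≠ 0 := fun t => sub_ne_zero.2 fun e => hball hy ⟨t, e⟩
    -- The ratio stays within distance less than 1 of 1, so the principal logarithm is a primitive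
    -- of the difference of integrands along the whole curve. It vanishes at both ends, where the
    -- ratio tends to 1.
    have hslit : ∀ t, (γ t - y) / (γ t - x) ∈ slitPlane := fun t => by
      have h1 : (γ t - y) / (γ t - x) = 1 + (x - y) / (γ t - x) := by
        have := hx0 t
        field_simp; ring
      rw [h1]
      refine mem_slitPlane_of_norm_lt_one ?_
      rw [norm_div, div_lt_one (hr.trans_le (hx t)), norm_sub_rev]
      exact hyx.trans_le (hx t)
    have hF : ∀ z ∈ Set.range γ, HasDerivAt (fun z => log ((z - y) / (z - x)))
        ((z - y)⁻¹ - (z - x)⁻¹) z := by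
      rintro _ ⟨t, rfl⟩
      have h1 : HasDerivAt (fun z => log ((z - y) / (z - x))) _ (γ t) :=
        (((hasDerivAt_id' (γ t)).sub_const y).div ((hasDerivAt_id' (γ t)).sub_const x)
          (hx0 t)).clog (hslit t)
      convert h1 using 1
      have := hx0 t
      have := hy0 t
      simp only [Pi.div_apply]
      field_simp
    have hcx : Continuous fun t => (γ t - x)⁻¹ := (h.continuous.sub continuous_const).inv₀ hx0
    have hcy : Continuous fun t => (γ t - y)⁻¹ := (h.continuous.sub continuous_const).inv₀ hy0
    have hint : ∀ R : ℝ, (∫ t in -R..R, deriv γ t * (γ t - y)⁻¹) -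
        ∫ t in -R..R, deriv γ t * (γ t - x)⁻¹ =
        log ((γ R - y) / (γ R - x)) - log ((γ (-R) - y) / (γ (-R) - x)) := fun R => by
      rw [← intervalIntegral.integral_sub (h.intervalIntegrable hcy _ _)
        (h.intervalIntegrable hcx _ _), ← h.integral_eq_sub (U := Set.range γ) (fun t => ⟨t, rfl⟩) hF]
      · congr 1; ext t; ring
      · rintro _ ⟨t, rfl⟩
        exact (((continuousAt_id.sub continuousAt_const).inv₀ (hy0 t)).sub
          ((continuousAt_id.sub continuousAt_const).inv₀ (hx0 t))).continuousWithinAt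
    have h1 : Tendsto (fun R : ℝ => (γ R - y) / (γ R - x)) atTop (𝓝 1) := by
      have := (h.tendsto_div_right y).div (h.tendsto_div_right x) one_ne_zero
      rw [div_one] at this
      refine this.congr' ?_
      filter_upwards [eventually_ne_atTop 0] with R hR
      exact div_div_div_cancel_right₀ (by exact_mod_cast hR) _ _
    have h2 : Tendsto (fun R : ℝ => (γ (-R) - y) / (γ (-R) - x)) atTop (𝓝 1) := by
      have := (h.tendsto_div_left y).div (h.tendsto_div_left x) (by norm_num)
      rw [div_self (by norm_num)] at this
      refine this.congr' ?_
      filter_upwards [eventually_ne_atTop 0] with R hR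
      exact div_div_div_cancel_right₀ (by exact_mod_cast hR) _ _
    have key := (h1.clog one_mem_slitPlane).sub (h2.clog one_mem_slitPlane)
    simp_rw [← hint] at key
    simpa using key.neg
  · intro x y z _ _ _ hxy hyz
    simpa using hxy.add hyz
  · intro x y _ _ hxy
    simpa using hxy.neg

/-- The ends of the primitive of `1/(z - p)` along a curve on one side of `p`. -/
lemma tendsto_log_right (u p : ℂ) (hu : u ∈ slitPlane) :
    Tendsto (fun R : ℝ => log (u * (γ R - p)) - Real.log R) atTop (𝓝 (log u)) := by
  have h1 := ((h.tendsto_div_right p).const_mul u)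
  rw [mul_one] at h1
  refine (h1.clog hu).congr' ?_
  filter_upwards [eventually_gt_atTop 0, h1.eventually (isOpen_slitPlane.mem_nhds hu)] with R hR hs
  have hR' : (R : ℂ) ≠ 0 := by exact_mod_cast hR.ne'
  have h2 : u * (γ R - p) = R * (u * ((γ R - p) / R)) := by field_simp
  rw [h2, log_ofReal_mul hR (slitPlane_ne_zero hs)]
  ring

lemma tendsto_log_left (u p : ℂ) (hu : -u ∈ slitPlane) :
    Tendsto (fun R : ℝ => log (u * (γ (-R) - p)) - Real.log R) atTop (𝓝 (log (-u))) := by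
  have h1 := ((h.tendsto_div_left p).const_mul u)
  rw [mul_neg_one] at h1
  refine (h1.clog hu).congr' ?_
  filter_upwards [eventually_gt_atTop 0, h1.eventually (isOpen_slitPlane.mem_nhds hu)] with R hR hs
  have hR' : (R : ℂ) ≠ 0 := by exact_mod_cast hR.ne'
  have h2 : u * (γ (-R) - p) = R * (u * ((γ (-R) - p) / R)) := by field_simp
  rw [h2, log_ofReal_mul hR (slitPlane_ne_zero hs)]
  ring

/-- The truncated integral of `1/(z - p)` along a curve on one side of `p`. -/
lemma tendsto_integral_inv_sub_of_re_pos {u p : ℂ} (hu : u ∈ slitPlane) (hu' : -u ∈ slitPlane)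
    (hp : ∀ t, 0 < (u * (γ t - p)).re) :
    Tendsto (fun R : ℝ => ∫ t in -R..R, deriv γ t * (γ t - p)⁻¹) atTop
      (𝓝 (log u - log (-u))) := by
  have h0 : ∀ t, γ t - p ≠ 0 := fun t e => by simpa [e] using hp t
  have hF : ∀ z ∈ Set.range γ, HasDerivAt (fun z => log (u * (z - p))) ((z - p)⁻¹) z := by
    rintro _ ⟨t, rfl⟩
    have h1 := (((hasDerivAt_id' (γ t)).sub_const p).const_mul u).clog (Or.inl (hp t))
    convert h1 using 1
    have := h0 t
    have := slitPlane_ne_zero hu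
    field_simp
  -- Each end of the primitive diverges like `log R`. Subtracting this from both makes the two
  -- limits exist separately.
  have hint : ∀ R : ℝ, (∫ t in -R..R, deriv γ t * (γ t - p)⁻¹) =
      (log (u * (γ R - p)) - Real.log R) - (log (u * (γ (-R) - p)) - Real.log R) := fun R => by
    rw [h.integral_eq_sub (U := Set.range γ) (fun t => ⟨t, rfl⟩) hF]
    · ring
    · rintro _ ⟨t, rfl⟩
      exact ((continuousAt_id.sub continuousAt_const).inv₀ (h0 t)).continuousWithinAt
  simp_rw [hint]
  exact (h.tendsto_log_right u p hu).sub (h.tendsto_log_left u p hu')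

/-- The truncated integral of `1/(z - p)` for `p` above the curve. -/
lemma tendsto_integral_inv_sub_of_above {p : ℂ}
    (hp : ∀ᶠ y : ℝ in atTop, JoinedIn (Set.range γ)ᶜ p ((y : ℂ) * I)) :
    Tendsto (fun R : ℝ => ∫ t in -R..R, deriv γ t * (γ t - p)⁻¹) atTop
      (𝓝 (log I - log (-I))) := by
  obtain ⟨Y, -, hY⟩ := h.exists_strip
  obtain ⟨y, hy, hyY⟩ := (hp.and (eventually_gt_atTop Y)).exists
  have h1 := h.tendsto_integral_inv_sub_of_re_pos (u := I) (p := y * I) (by simp [slitPlane])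
    (by simp [slitPlane]) (fun t => by
      have := (abs_lt.1 (show |(γ t).im| < Y from hY t)).2
      simp; linarith)
  simpa using (h.tendsto_integral_inv_sub_of_joinedIn hy).add h1

/-- The truncated integral of `1/(z - p)` for `p` below the curve. -/
lemma tendsto_integral_inv_sub_of_below {p : ℂ}
    (hp : ∀ᶠ y : ℝ in atBot, JoinedIn (Set.range γ)ᶜ p ((y : ℂ) * I)) :
    Tendsto (fun R : ℝ => ∫ t in -R..R, deriv γ t * (γ t - p)⁻¹) atTop
      (𝓝 (log (-I) - log I)) := by
  obtain ⟨Y, -, hY⟩ := h.exists_strip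
  obtain ⟨y, hy, hyY⟩ := (hp.and (eventually_lt_atBot (-Y))).exists
  have h1 := h.tendsto_integral_inv_sub_of_re_pos (u := -I) (p := y * I) (by simp [slitPlane])
    (by simp [slitPlane]) (fun t => by
      have := (abs_lt.1 (show |(γ t).im| < Y from hY t)).1
      simp; linarith)
  rw [neg_neg] at h1
  simpa using (h.tendsto_integral_inv_sub_of_joinedIn hy).add h1

end HorizontalEnds

/-! ### Comparison of two curves: primitives, principal parts and holomorphic functions. -/

/-- The truncated integrals of `f` along two curves agree in the limit. -/
def LoopNull (γ₁ γ₂ : ℝ → ℂ) (f : ℂ → ℂ) : Prop :=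
  Tendsto (fun R : ℝ => (∫ t in -R..R, deriv γ₁ t * f (γ₁ t)) -
    ∫ t in -R..R, deriv γ₂ t * f (γ₂ t)) atTop (𝓝 0)

lemma loopNull_of_hasDerivAt {γ₁ γ₂ : ℝ → ℂ} (h₁ : HorizontalEnds γ₁) (h₂ : HorizontalEnds γ₂)
    {U : Set ℂ} (hU₁ : ∀ t, γ₁ t ∈ U) (hU₂ : ∀ t, γ₂ t ∈ U) {F f : ℂ → ℂ}
    (hF : ∀ z ∈ U, HasDerivAt F (f z) z) (hf : ContinuousOn f U)
    (hr : Tendsto (fun R : ℝ => F (γ₁ R) - F (γ₂ R)) atTop (𝓝 0))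
    (hl : Tendsto (fun R : ℝ => F (γ₁ R) - F (γ₂ R)) atBot (𝓝 0)) : LoopNull γ₁ γ₂ f := by
  have := hr.sub (hl.comp tendsto_neg_atTop_atBot)
  rw [sub_zero] at this
  refine this.congr fun R => ?_
  rw [h₁.integral_eq_sub hU₁ hF hf, h₂.integral_eq_sub hU₂ hF hf, Function.comp_apply]
  ring

/-- Functions which are continuous on two curves, have truncated integrals that agree in the limit,
and tend to zero at the ends of a strip. -/
structure Negligible (γ₁ γ₂ : ℝ → ℂ) (Y : ℝ) (f : ℂ → ℂ) : Prop where
  continuous₁ : Continuous fun t => f (γ₁ t)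
  continuous₂ : Continuous fun t => f (γ₂ t)
  loopNull : LoopNull γ₁ γ₂ f
  tendsto : Tendsto f (stripEnds Y) (𝓝 0)

section

variable {γ₁ γ₂ : ℝ → ℂ} (h₁ : HorizontalEnds γ₁) (h₂ : HorizontalEnds γ₂) {Y : ℝ}

lemma Negligible.congr {f g : ℂ → ℂ} (hf : Negligible γ₁ γ₂ Y f)
    (e₁ : ∀ t, f (γ₁ t) = g (γ₁ t)) (e₂ : ∀ t, f (γ₂ t) = g (γ₂ t))
    (e : f =ᶠ[stripEnds Y] g) : Negligible γ₁ γ₂ Y g := by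
  refine ⟨by simpa only [← e₁] using hf.continuous₁, by simpa only [← e₂] using hf.continuous₂, ?_,
    hf.tendsto.congr' e⟩
  simpa only [LoopNull, ← e₁, ← e₂] using hf.loopNull

lemma Negligible.const_mul {f : ℂ → ℂ} (hf : Negligible γ₁ γ₂ Y f) (c : ℂ) :
    Negligible γ₁ γ₂ Y (fun z => c * f z) := by
  refine ⟨hf.continuous₁.const_mul c, hf.continuous₂.const_mul c, ?_, ?_⟩
  · have := Tendsto.const_mul c hf.loopNull
    rw [mul_zero] at this
    refine this.congr fun R => ?_
    simp only [mul_left_comm _ c, intervalIntegral.integral_const_mul]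
    ring
  · simpa using hf.tendsto.const_mul c

include h₁ h₂

lemma Negligible.add {f g : ℂ → ℂ} (hf : Negligible γ₁ γ₂ Y f) (hg : Negligible γ₁ γ₂ Y g) :
    Negligible γ₁ γ₂ Y (fun z => f z + g z) := by
  refine ⟨hf.continuous₁.add hg.continuous₁, hf.continuous₂.add hg.continuous₂, ?_, ?_⟩
  · have := Tendsto.add hf.loopNull hg.loopNull
    rw [add_zero] at this
    refine this.congr fun R => ?_
    simp only [mul_add]
    rw [intervalIntegral.integral_add (h₁.intervalIntegrable hf.continuous₁ _ _)
      (h₁.intervalIntegrable hg.continuous₁ _ _),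
      intervalIntegral.integral_add (h₂.intervalIntegrable hf.continuous₂ _ _)
      (h₂.intervalIntegrable hg.continuous₂ _ _)]
    ring
  · simpa using hf.tendsto.add hg.tendsto

omit h₁ h₂

/-- A point off two curves which lies on the same side of both. -/
structure SameSide (γ₁ γ₂ : ℝ → ℂ) (p : ℂ) : Prop where
  ne₁ : ∀ t, γ₁ t ≠ p
  ne₂ : ∀ t, γ₂ t ≠ p
  loopNull : LoopNull γ₁ γ₂ fun z => (z - p)⁻¹

lemma tendsto_inv_sub_stripEnds (Y : ℝ) (p : ℂ) :
    Tendsto (fun z => (z - p)⁻¹) (stripEnds Y) (𝓝 0) :=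
  tendsto_inv₀_cobounded.comp
    ((tendsto_sub_const_cobounded p).mono_left (stripEnds_le_cobounded Y))

lemma SameSide.negligible {p : ℂ} (hp : SameSide γ₁ γ₂ p) (h₁ : HorizontalEnds γ₁)
    (h₂ : HorizontalEnds γ₂) (Y : ℝ) : Negligible γ₁ γ₂ Y fun z => (z - p)⁻¹ :=
  ⟨(h₁.continuous.sub continuous_const).inv₀ fun t => sub_ne_zero.2 (hp.ne₁ t),
    (h₂.continuous.sub continuous_const).inv₀ fun t => sub_ne_zero.2 (hp.ne₂ t), hp.loopNull,
    tendsto_inv_sub_stripEnds Y p⟩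

include h₁ h₂

/-- Only the simple pole uses the side of `p`. Higher powers have the single-valued primitive `-(z -
p)^{-k}/k`, which vanishes at infinity. -/
lemma SameSide.negligible_pow {p : ℂ} (hp : SameSide γ₁ γ₂ p) (Y : ℝ) (k : ℕ) :
    Negligible γ₁ γ₂ Y fun z => (z - p)⁻¹ ^ (k + 1) := by
  rcases Nat.eq_zero_or_pos k with rfl | hk
  · simpa using hp.negligible h₁ h₂ Y
  have hn := hp.negligible h₁ h₂ Y
  refine ⟨hn.continuous₁.pow _, hn.continuous₂.pow _, ?_, by simpa using hn.tendsto.pow (k + 1)⟩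
  have key : ∀ {γ : ℝ → ℂ} {l : Filter ℝ}, Tendsto γ l (Bornology.cobounded ℂ) →
      Tendsto (fun R => -(k : ℂ)⁻¹ * (γ R - p)⁻¹ ^ k) l (𝓝 0) := fun hγ => by
    have := (((tendsto_inv₀_cobounded (α := ℂ)).comp
      ((tendsto_sub_const_cobounded p).comp hγ)).pow k).const_mul (-(k : ℂ)⁻¹)
    simpa [zero_pow hk.ne'] using this
  refine loopNull_of_hasDerivAt h₁ h₂ (U := {p}ᶜ) hp.ne₁ hp.ne₂
    (F := fun z => -(k : ℂ)⁻¹ * (z - p)⁻¹ ^ k) (fun z hz => ?_) ?_ ?_ ?_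
  · have hz' : z - p ≠ 0 := sub_ne_zero.2 hz
    have h3 : HasDerivAt (fun z => -(k : ℂ)⁻¹ * (z - p)⁻¹ ^ k) _ z :=
      ((((hasDerivAt_id' z).sub_const p).inv hz').pow k).const_mul (-(k : ℂ)⁻¹)
    refine h3.congr_deriv ?_
    have : (k : ℂ) ≠ 0 := by exact_mod_cast hk.ne'
    obtain ⟨j, rfl⟩ := Nat.exists_eq_succ_of_ne_zero hk.ne'
    simp only [Pi.inv_apply, Nat.succ_eq_add_one, Nat.add_sub_cancel, inv_pow]
    field_simp
    ring
  · exact ((continuousOn_id.sub continuousOn_const).inv₀ fun z hz => sub_ne_zero.2 hz).pow _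
  · simpa using (key h₁.tendsto_cobounded_right).sub (key h₂.tendsto_cobounded_right)
  · simpa using (key h₁.tendsto_cobounded_left).sub (key h₂.tendsto_cobounded_left)

/-- Partial fractions by induction on the number of factors: two distinct points `p`, `q` are
separated by `1/((z-p)(z-q)) = (1/(z-p) - 1/(z-q))/(p-q)`, and if all points coincide the product is
a pure power. -/
lemma negligible_prod_inv (Y : ℝ) : ∀ (n : ℕ) (s : Multiset ℂ), s.card = n + 1 →
    (∀ p ∈ s, SameSide γ₁ γ₂ p) →
    Negligible γ₁ γ₂ Y fun z => (s.map fun p => (z - p)⁻¹).prod := by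
  intro n
  induction n with
  | zero =>
    intro s hs hp
    obtain ⟨p, rfl⟩ := Multiset.card_eq_one.1 hs
    simpa using (hp p (by simp)).negligible h₁ h₂ Y
  | succ n ih =>
    intro s hs hp
    obtain ⟨p, s', rfl⟩ := Multiset.card_pos_iff_exists_mem.1 (by omega : 0 < s.card) |>.imp
      fun p hp => Multiset.exists_cons_of_mem hp
    rw [Multiset.card_cons, add_left_inj] at hs
    by_cases hall : ∀ q ∈ s', q = p
    · rw [Multiset.eq_replicate_of_mem hall, hs]
      have := (hp p (by simp)).negligible_pow h₁ h₂ Y (n + 1)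
      simpa [pow_succ', mul_comm] using this
    push Not at hall
    obtain ⟨q, hq, hqp⟩ := hall
    obtain ⟨s, rfl⟩ := Multiset.exists_cons_of_mem hq
    have hs' : s.card = n := by simpa using hs
    have hpq := (ih (p ::ₘ s) (by simp [hs']) fun x hx => hp x (by
      rcases Multiset.mem_cons.1 hx with rfl | hx <;> simp [*])).add h₁ h₂
      ((ih (q ::ₘ s) (by simp [hs']) fun x hx => hp x (by
      rcases Multiset.mem_cons.1 hx with rfl | hx <;> simp [*])).const_mul (-1))
    have key : ∀ z, z ≠ p → z ≠ q → (p - q)⁻¹ * (((p ::ₘ s).map fun p => (z - p)⁻¹).prod +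
        -1 * ((q ::ₘ s).map fun p => (z - p)⁻¹).prod) =
        ((p ::ₘ q ::ₘ s).map fun p => (z - p)⁻¹).prod := fun z hzp hzq => by
      have e1 : z - p ≠ 0 := sub_ne_zero.2 hzp
      have e2 : z - q ≠ 0 := sub_ne_zero.2 hzq
      have e3 : p - q ≠ 0 := sub_ne_zero.2 hqp.symm
      simp only [Multiset.map_cons, Multiset.prod_cons]
      field_simp
      ring
    have hsp := hp p (by simp)
    have hsq := hp q (by simp)
    refine (hpq.const_mul (p - q)⁻¹).congr (fun t => key _ (hsp.ne₁ t) (hsq.ne₁ t))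
      (fun t => key _ (hsp.ne₂ t) (hsq.ne₂ t)) ?_
    filter_upwards [stripEnds_le_cobounded Y (Bornology.eventually_ne_cobounded p),
      stripEnds_le_cobounded Y (Bornology.eventually_ne_cobounded q)] with z hz hz'
    exact key z hz hz'

/-- Splitting off the principal parts. -/
lemma exists_sub_negligible (s : Multiset ℂ) : ∀ (g : ℂ → ℂ), DifferentiableOn ℂ g (strip Y) →
    (∀ p ∈ s, SameSide γ₁ γ₂ p) →
    ∃ f r : ℂ → ℂ, DifferentiableOn ℂ f (strip Y) ∧ Negligible γ₁ γ₂ Y r ∧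
      ∀ z, z ∉ s → g z * (s.map fun p => (z - p)⁻¹).prod = f z + r z := by
  induction s using Multiset.induction with
  | empty =>
    intro g hg _
    refine ⟨g, fun _ => 0, hg, ⟨continuous_const, continuous_const, ?_, tendsto_const_nhds⟩, ?_⟩
    · simp [LoopNull]
    · simp
  | cons p s ih =>
    intro g hg hs
    -- One pole is removed by `g(z)/(z-p) = dslope g p z + g(p)/(z-p)`. The divided difference is
    -- holomorphic whether or not `p` lies in the strip; the second term, times the remaining
    -- factors, is negligible.
    have hd : DifferentiableOn ℂ (dslope g p) (strip Y) := by
      by_cases hp : p ∈ strip Y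
      · exact (differentiableOn_dslope ((isOpen_strip Y).mem_nhds hp)).2 hg
      · exact (differentiableOn_dslope_of_notMem hp).2 hg
    obtain ⟨f, r, hf, hr, hfr⟩ := ih (dslope g p) hd fun q hq => hs q (by simp [hq])
    refine ⟨f, fun z => r z + g p * ((p ::ₘ s).map fun p => (z - p)⁻¹).prod, hf,
      hr.add h₁ h₂ ((negligible_prod_inv h₁ h₂ Y _ (p ::ₘ s) (Multiset.card_cons _ _)
        hs).const_mul _), fun z hz => ?_⟩
    have hz1 : z - p ≠ 0 := sub_ne_zero.2 fun e => hz (by simp [e])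
    have h3 := hfr z fun e => hz (by simp [e])
    rw [← add_assoc, ← h3, Multiset.map_cons, Multiset.prod_cons,
      dslope_of_ne _ (sub_ne_zero.1 hz1), slope_def_field]
    field_simp
    ring

/-- The convex strip carries a primitive `F`. Near the ends the two curves stay at bounded distance
while `F' = f` tends to zero, so the mean value inequality makes the two values of `F` agree in the
limit. -/
lemma loopNull_of_differentiableOn (hY₁ : ∀ t, γ₁ t ∈ strip Y) (hY₂ : ∀ t, γ₂ t ∈ strip Y)
    {f : ℂ → ℂ} (hf : DifferentiableOn ℂ f (strip Y)) (hlim : Tendsto f (stripEnds Y) (𝓝 0)) :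
    LoopNull γ₁ γ₂ f := by
  obtain ⟨F, hF⟩ := (convex_strip Y).exists_forall_hasDerivWithinAt hf
  have hF' : ∀ z ∈ strip Y, HasDerivAt F (f z) z := fun z hz =>
    (hF z hz).hasDerivAt ((isOpen_strip Y).mem_nhds hz)
  have key : ∀ (S : ℝ → Set ℂ), (∀ x, Convex ℝ (S x)) → (∀ x z, z ∈ S x → x ≤ |z.re|) →
      ∀ (l : Filter ℝ), (∀ x, ∀ᶠ t in l, γ₁ t ∈ S x ∧ γ₂ t ∈ S x) →
      (∃ M, ∀ᶠ t in l, ‖γ₁ t - γ₂ t‖ ≤ M) → Tendsto (fun R => F (γ₁ R) - F (γ₂ R)) l (𝓝 0) := by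
    intro S hS hS' l hl ⟨M, hM⟩
    rw [Metric.tendsto_nhds]
    intro ε hε
    have hδ : 0 < ε / (|M| + 1) := by positivity
    obtain ⟨x, hx⟩ := eventually_stripEnds.1 (Metric.tendsto_nhds.1 hlim _ hδ)
    filter_upwards [hl x, hM] with t ht hMt
    have := ((hS x).inter (convex_strip Y)).norm_image_sub_le_of_norm_hasDerivWithin_le
      (f := F) (f' := f) (C := ε / (|M| + 1)) (fun z hz => (hF' z hz.2).hasDerivWithinAt)
      (fun z hz => by simpa using (hx z hz.2 (hS' x z hz.1)).le) ⟨ht.2, hY₂ t⟩ ⟨ht.1, hY₁ t⟩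
    rw [dist_zero_right]
    calc _ ≤ ε / (|M| + 1) * ‖γ₁ t - γ₂ t‖ := this
      _ ≤ ε / (|M| + 1) * |M| := by gcongr; exact hMt.trans (le_abs_self M)
      _ < ε := by
        rw [div_mul_eq_mul_div, div_lt_iff₀ (by positivity)]
        nlinarith
  obtain ⟨c₁, hc₁⟩ := h₁.right_end
  obtain ⟨c₂, hc₂⟩ := h₂.right_end
  obtain ⟨d₁, hd₁⟩ := h₁.left_end
  obtain ⟨d₂, hd₂⟩ := h₂.left_end
  refine loopNull_of_hasDerivAt h₁ h₂ hY₁ hY₂ hF' hf.continuousOn ?_ ?_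
  · refine key (fun x => {z | x ≤ z.re}) (fun x => convex_halfSpace_re_ge x)
      (fun x z hz => le_trans hz (le_abs_self _)) _ (fun x => ?_) ⟨‖c₁ - c₂‖, ?_⟩
    · filter_upwards [hc₁, hc₂, eventually_ge_atTop (x - c₁.re), eventually_ge_atTop (x - c₂.re)]
        with t e1 e2 e3 e4
      simp only [e1, e2, add_re, ofReal_re]
      exact ⟨by linarith, by linarith⟩
    · filter_upwards [hc₁, hc₂] with t e1 e2
      simp [e1, e2]
  · refine key (fun x => {z | z.re ≤ -x}) (fun x => convex_halfSpace_re_le _)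
      (fun x z hz => (le_neg_of_le_neg hz).trans (neg_le_abs _)) _ (fun x => ?_) ⟨‖d₁ - d₂‖, ?_⟩
    · filter_upwards [hd₁, hd₂, eventually_le_atBot (-x - d₁.re), eventually_le_atBot (-x - d₂.re)]
        with t e1 e2 e3 e4
      simp only [e1, e2, add_re, ofReal_re]
      exact ⟨by linarith, by linarith⟩
    · filter_upwards [hd₁, hd₂] with t e1 e2
      simp [e1, e2]

omit h₁ h₂

/-! ### Meromorphic functions in a strip. -/

/-- `f` is holomorphic in a strip up to finitely many poles in the set `S`. -/
def StripMero (Y : ℝ) (S : Set ℂ) (f : ℂ → ℂ) : Prop :=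
  ∃ (g : ℂ → ℂ) (s : Multiset ℂ), DifferentiableOn ℂ g (strip Y) ∧ (∀ p ∈ s, p ∈ S) ∧
    ∀ z ∈ strip Y, z ∉ S → f z = g z * (s.map fun p => (z - p)⁻¹).prod

lemma StripMero.of_differentiableOn {S : Set ℂ} {f : ℂ → ℂ} (hf : DifferentiableOn ℂ f (strip Y)) :
    StripMero Y S f :=
  ⟨f, 0, hf, by simp, by simp⟩

lemma StripMero.inv_sub {S : Set ℂ} {p : ℂ} (hp : p ∈ S) : StripMero Y S fun z => (z - p)⁻¹ :=
  ⟨fun _ => 1, {p}, by fun_prop, by simpa using hp, by simp⟩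

lemma StripMero.mul {S : Set ℂ} {f g : ℂ → ℂ} (hf : StripMero Y S f) (hg : StripMero Y S g) :
    StripMero Y S fun z => f z * g z := by
  obtain ⟨f', s, hf', hs, hfs⟩ := hf
  obtain ⟨g', s', hg', hs', hgs⟩ := hg
  refine ⟨fun z => f' z * g' z, s + s', hf'.mul hg', fun p hp => ?_, fun z hz hzS => ?_⟩
  · exact (Multiset.mem_add.1 hp).elim (hs p) (hs' p)
  · simp only [hfs z hz hzS, hgs z hz hzS, Multiset.map_add, Multiset.prod_add]
    ring

lemma StripMero.prod {S : Set ℂ} {ι : Type*} (t : Finset ι) {f : ι → ℂ → ℂ}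
    (hf : ∀ i ∈ t, StripMero Y S (f i)) : StripMero Y S fun z => ∏ i ∈ t, f i z := by
  classical
  induction t using Finset.induction_on with
  | empty => simpa using StripMero.of_differentiableOn (differentiableOn_const (1 : ℂ))
  | insert i t hi ih =>
    simp only [Finset.prod_insert hi]
    exact (hf i (by simp)).mul (ih fun j hj => hf j (by simp [hj]))

lemma StripMero.congr {S : Set ℂ} {f g : ℂ → ℂ} (hf : StripMero Y S f)
    (h : ∀ z ∈ strip Y, z ∉ S → f z = g z) : StripMero Y S g := by
  obtain ⟨f', s, hf', hs, hfs⟩ := hf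
  exact ⟨f', s, hf', hs, fun z hz hzS => (h z hz hzS).symm.trans (hfs z hz hzS)⟩

lemma StripMero.continuous_comp {S : Set ℂ} {f : ℂ → ℂ} (hf : StripMero Y S f) {γ : ℝ → ℂ}
    (hγ : Continuous γ) (hY : ∀ t, γ t ∈ strip Y) (hS : ∀ t, γ t ∉ S) :
    Continuous fun t => f (γ t) := by
  obtain ⟨g, s, hg, hs, hfs⟩ := hf
  simp only [hfs _ (hY _) (hS _)]
  refine (hg.continuousOn.comp_continuous hγ hY).mul (continuous_multiset_prod _ fun p hp => ?_)
  exact (hγ.sub continuous_const).inv₀ fun t => sub_ne_zero.2 fun e => hS t (e ▸ hs p hp)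

include h₁ h₂

/-- Deformation of contours in a strip for a meromorphic function each of whose poles is on the same
side of both curves. -/
lemma StripMero.loopNull {S : Set ℂ} {f : ℂ → ℂ} (hf : StripMero Y S f)
    (hY₁ : ∀ t, γ₁ t ∈ strip Y) (hY₂ : ∀ t, γ₂ t ∈ strip Y)
    (hS : ∀ p ∈ S, SameSide γ₁ γ₂ p) (hS' : ∀ᶠ z in stripEnds Y, z ∉ S)
    (hlim : Tendsto f (stripEnds Y) (𝓝 0)) :
    LoopNull γ₁ γ₂ f := by
  obtain ⟨g, s, hg, hs, hfg⟩ := hf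
  obtain ⟨h, r, hh, hr, he⟩ := exists_sub_negligible h₁ h₂ s g hg fun p hp => hS p (hs p hp)
  have e : ∀ z ∈ strip Y, z ∉ S → f z = h z + r z := fun z hz hzs =>
    (hfg z hz hzs).trans (he z fun hzs' => hzs (hs z hzs'))
  -- The holomorphic part inherits decay from `f`, because the principal parts decay too.
  have hlim' : Tendsto h (stripEnds Y) (𝓝 0) := by
    have := hlim.sub hr.tendsto
    rw [sub_zero] at this
    refine this.congr' ?_
    have hst : ∀ᶠ z in stripEnds Y, z ∈ strip Y := mem_inf_of_right (mem_principal_self _)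
    filter_upwards [hS', hst] with z hz hz'
    rw [e z hz' hz]; ring
  have hn : Negligible γ₁ γ₂ Y h :=
    ⟨hh.continuousOn.comp_continuous h₁.continuous hY₁,
      hh.continuousOn.comp_continuous h₂.continuous hY₂,
      loopNull_of_differentiableOn h₁ h₂ hY₁ hY₂ hh hlim', hlim'⟩
  have := (hn.add h₁ h₂ hr).loopNull
  simp only [LoopNull] at this ⊢
  simpa only [e _ (hY₁ _) fun hm => (hS _ hm).ne₁ _ rfl,
    e _ (hY₂ _) fun hm => (hS _ hm).ne₂ _ rfl] using this

end

/-- The limiting integral of `1/(z - p)` is `log I - log (-I)` for every curve below `p`, and its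
negative for every curve above `p`. -/
lemma IsContour.sameSide {n : ℕ} {β : Fin n → ℂ} {γ₁ γ₂ : ℝ → ℂ} (h₁ : IsContour β γ₁)
    (h₂ : IsContour β γ₂) {p : ℂ}
    (hp : (∃ (j : Fin n) (k : ℕ), p = β j - Real.pi * I + 2 * Real.pi * I * k) ∨
      ∃ (j : Fin n) (k : ℕ), p = β j - 2 * Real.pi * I * k) : SameSide γ₁ γ₂ p := by
  have ne : ∀ {γ : ℝ → ℂ}, IsContour β γ → ∀ t, γ t ≠ p := by
    rintro γ hγ t rfl
    rcases hp with ⟨j, k, e⟩ | ⟨j, k, e⟩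
    · obtain ⟨y, hy⟩ := (hγ.above j k).exists
      exact hy.source_mem ⟨t, e⟩
    · obtain ⟨y, hy⟩ := (hγ.below j k).exists
      exact hy.source_mem ⟨t, e⟩
  refine ⟨ne h₁, ne h₂, ?_⟩
  rcases hp with ⟨j, k, rfl⟩ | ⟨j, k, rfl⟩
  · simpa [LoopNull] using (h₁.horizontalEnds.tendsto_integral_inv_sub_of_above (h₁.above j k)).sub
      (h₂.horizontalEnds.tendsto_integral_inv_sub_of_above (h₂.above j k))
  · simpa [LoopNull] using (h₁.horizontalEnds.tendsto_integral_inv_sub_of_below (h₁.below j k)).sub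
      (h₂.horizontalEnds.tendsto_integral_inv_sub_of_below (h₂.below j k))

/-! Ratios of Gamma functions in vertical strips -/

/-- Telescoping of `((w + 1/2)/w)² (w - 1/2) = (w + 1/2)(1 - 1/(4w²))` at `w = z - 1/2 + j`.
Squaring avoids square roots and leaves a convergent product. -/
lemma prod_div_sq_mul (z : ℂ) (hz : z.im ≠ 0) (N : ℕ) :
    ((∏ j ∈ Finset.range N, (z + j)) / ∏ j ∈ Finset.range N, (z - 1 / 2 + j)) ^ 2 * (z - 1) =
      (z + N - 1) * ∏ j ∈ Finset.range N, (1 - 1 / (4 * (z - 1 / 2 + j) ^ 2)) := by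
  induction N with
  | zero => simp
  | succ N ih =>
    have h1 : z - 1 / 2 + N ≠ 0 := fun e => hz (by simpa using congrArg im e)
    have h2 : z + N - 1 ≠ 0 := fun e => hz (by simpa using congrArg im e)
    rw [Finset.prod_range_succ, Finset.prod_range_succ, Finset.prod_range_succ, mul_div_mul_comm,
      mul_pow, mul_right_comm, ih]
    push_cast
    have h3 : ((z + N) / (z - 1 / 2 + N)) ^ 2 * (z + N - 1) =
        (z + (N + 1) - 1) * (1 - 1 / (4 * (z - 1 / 2 + N) ^ 2)) := by
      have h4 : ∀ w : ℂ, w ≠ 0 →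
          ((w + 1 / 2) / w) ^ 2 * (w - 1 / 2) = (w + 1 / 2) * (1 - 1 / (4 * w ^ 2)) := fun w hw => by
        field_simp
        ring
      rw [show z + N = (z - 1 / 2 + N) + 1 / 2 by ring,
        show z - 1 / 2 + N + 1 / 2 - 1 = (z - 1 / 2 + N) - 1 / 2 by ring,
        show z + (N + 1) - 1 = (z - 1 / 2 + N) + 1 / 2 by ring]
      exact h4 _ h1
    linear_combination (∏ j ∈ Finset.range N, (1 - 1 / (4 * (z - 1 / 2 + j) ^ 2))) * h3

lemma GammaSeq_div_sq_mul (z : ℂ) (hz : z.im ≠ 0) {N : ℕ} (hN : N ≠ 0) :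
    (GammaSeq (z - 1 / 2) N / GammaSeq z N) ^ 2 * (z - 1) =
      (z / N + 1) * ∏ j ∈ Finset.range (N + 1), (1 - 1 / (4 * (z - 1 / 2 + j) ^ 2)) := by
  have hN' : (N : ℂ) ≠ 0 := by exact_mod_cast hN
  have hf : (N.factorial : ℂ) ≠ 0 := by exact_mod_cast N.factorial_ne_zero
  have h := prod_div_sq_mul z hz (N + 1)
  have e1 : GammaSeq (z - 1 / 2) N / GammaSeq z N = (N : ℂ) ^ (-(1 / 2) : ℂ) *
      ((∏ j ∈ Finset.range (N + 1), (z + j)) / ∏ j ∈ Finset.range (N + 1), (z - 1 / 2 + j)) := by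
    rw [GammaSeq, GammaSeq, sub_eq_add_neg z, cpow_add _ _ hN']
    have : (N : ℂ) ^ z ≠ 0 := by simp [cpow_eq_zero_iff, hN']
    field_simp
  have e2 : ((N : ℂ) ^ (-(1 / 2) : ℂ)) ^ 2 = (N : ℂ)⁻¹ := by
    rw [← cpow_nat_mul]
    norm_num [cpow_neg_one]
  rw [e1, mul_pow, e2, mul_assoc, h]
  push_cast
  field_simp
  ring

lemma summable_inv_sq : Summable fun j : ℕ => (((j : ℝ) + 1) ^ 2)⁻¹ := by
  have := (summable_nat_add_iff 1).2 (Real.summable_nat_pow_inv.2 (by norm_num : 1 < 2))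
  simpa using this

lemma exists_norm_prod_le (X : ℝ) : ∃ C : ℝ, 0 < C ∧ ∀ z : ℂ, |z.re| ≤ X → 1 ≤ |z.im| → ∀ N : ℕ,
    ‖∏ j ∈ Finset.range N, (1 - 1 / (4 * (z - 1 / 2 + j) ^ 2))‖ ≤ C := by
  set D := (|X| + 2) ^ 2
  have hD : 0 < D := by positivity
  refine ⟨Real.exp (∑' j : ℕ, D * (((j : ℝ) + 1) ^ 2)⁻¹), Real.exp_pos _, fun z hx hy N => ?_⟩
  have key : ∀ j : ℕ, ‖1 - 1 / (4 * (z - 1 / 2 + j) ^ 2)‖ ≤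
      Real.exp (D * (((j : ℝ) + 1) ^ 2)⁻¹) := fun j => by
    set w := z - 1 / 2 + j
    have hw : ‖w‖ ^ 2 = (z.re - 1 / 2 + j) ^ 2 + z.im ^ 2 := by
      rw [← normSq_eq_norm_sq, normSq_apply]
      simp [w]; ring
    have hy2 : 1 ≤ z.im ^ 2 := by rw [← sq_abs]; nlinarith
    -- Write `j + 1 = Re w + (3/2 - Re z)`. The second summand is bounded in the strip, and `|Im w|
    -- ≥ 1` absorbs it; this gives quadratic growth uniform in `z`.
    have hw1 : ((j : ℝ) + 1) ^ 2 ≤ 2 * D * ‖w‖ ^ 2 := by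
      rw [hw]
      have h1 : (3 / 2 - z.re) ^ 2 ≤ D := by
        refine sq_le_sq' ?_ ?_ <;> cases abs_le.1 hx <;> linarith [le_abs_self X]
      have h2 : 1 ≤ D := by
        have := abs_nonneg X
        nlinarith
      have h3 : ((j : ℝ) + 1) ^ 2 ≤ 2 * (z.re - 1 / 2 + j) ^ 2 + 2 * (3 / 2 - z.re) ^ 2 := by
        nlinarith [sq_nonneg ((z.re - 1 / 2 + j) - (3 / 2 - z.re))]
      nlinarith [sq_nonneg (z.re - 1 / 2 + j)]
    have hw0 : 0 < ‖w‖ ^ 2 := by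
      rw [hw]; positivity
    calc ‖1 - 1 / (4 * w ^ 2)‖ ≤ ‖(1 : ℂ)‖ + ‖1 / (4 * w ^ 2)‖ := norm_sub_le _ _
      _ = 1 / (4 * ‖w‖ ^ 2) + 1 := by simp; ring
      _ ≤ D * (((j : ℝ) + 1) ^ 2)⁻¹ + 1 := by
        gcongr
        rw [← div_eq_mul_inv, div_le_div_iff₀ (by positivity) (by positivity)]
        nlinarith
      _ ≤ _ := Real.add_one_le_exp _
  rw [norm_prod]
  refine (Finset.prod_le_prod (fun _ _ => norm_nonneg _) fun j _ => key j).trans ?_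
  rw [← Real.exp_sum]
  exact Real.exp_le_exp.2 ((summable_inv_sq.mul_left D).sum_le_tsum _ fun _ _ => by positivity)

/-- `Γ(z - 1/2) / Γ(z) = O(|z|^{-1/2})` in vertical strips. -/
lemma exists_norm_Gamma_div_sq_le (X : ℝ) : ∃ C : ℝ, 0 < C ∧ ∀ z : ℂ, |z.re| ≤ X → 1 ≤ |z.im| →
    ‖(Gamma (z - 1 / 2) / Gamma z) ^ 2‖ ≤ C * ‖z‖⁻¹ := by
  obtain ⟨C, hC, h⟩ := exists_norm_prod_le X
  refine ⟨2 * C, by positivity, fun z hx hy => ?_⟩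
  have hz : z.im ≠ 0 := by
    rintro e; rw [e] at hy; norm_num at hy
  have hz0 : z ≠ 0 := fun e => hz (by simp [e])
  have hG : Gamma z ≠ 0 := Gamma_ne_zero fun k e => hz (by simp [e])
  have h1 : Tendsto (fun N : ℕ => ‖(GammaSeq (z - 1 / 2) N / GammaSeq z N) ^ 2 * (z - 1)‖) atTop
      (𝓝 ‖(Gamma (z - 1 / 2) / Gamma z) ^ 2 * (z - 1)‖) :=
    ((((GammaSeq_tendsto_Gamma _).div (GammaSeq_tendsto_Gamma z) hG).pow 2).mul_const _).norm
  have h2 : Tendsto (fun N : ℕ => ‖z / N + 1‖ * C) atTop (𝓝 (‖(0 : ℂ) + 1‖ * C)) :=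
    ((tendsto_const_div_atTop_nhds_zero_nat z).add_const 1).norm.mul_const C
  have h3 := le_of_tendsto_of_tendsto h1 h2 (by
    filter_upwards [eventually_ne_atTop 0] with N hN
    rw [GammaSeq_div_sq_mul z hz hN, norm_mul]
    gcongr
    exact h z hx hy _)
  rw [zero_add, norm_one, one_mul, norm_mul] at h3
  have h4 : ‖z‖ ≤ 2 * ‖z - 1‖ := by
    have h5 : 1 ≤ ‖z - 1‖ := hy.trans (by simpa using abs_im_le_norm (z - 1))
    have h6 : ‖z‖ ≤ ‖z - 1‖ + ‖(1 : ℂ)‖ := by simpa using norm_add_le (z - 1) 1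
    rw [norm_one] at h6
    linarith
  rw [← div_eq_mul_inv, le_div_iff₀ (norm_pos_iff.2 hz0)]
  nlinarith [norm_nonneg ((Gamma (z - 1 / 2) / Gamma z) ^ 2)]

/-! The one-variable factors of the integrand -/

/-- The factor of `g_M` belonging to the integration variable attached to `m ∈ M`. -/
def gFactor {n : ℕ} (β : Fin n → ℂ) (m : Fin n) (α : ℂ) : ℂ :=
  1 / (α - β m) * ∏ j ∈ Finset.Iio m, (α - β j + Real.pi * I) / (α - β j)

/-- The one-variable building blocks of the integrand. -/
def oneVar {n : ℕ} (β : Fin n → ℂ) (m : Fin n) (d p : ℕ) (α : ℂ) : ℂ :=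
  phi β α * gFactor β m α * α ^ d * (exp (-α) ^ p / ∏ j, (1 - exp (-α) * (expNeg β j)⁻¹))

/-- The function `oneVar` with its removable singularities removed. -/
def oneVarReg {n : ℕ} (β : Fin n → ℂ) (m : Fin n) (d p : ℕ) (α : ℂ) : ℂ :=
  (∏ j, Gamma ((α - β j + Real.pi * I) / (-2 * Real.pi * I)) *
    Gamma (1 - (α - β j) / (-2 * Real.pi * I)) *
    (-exp (-(Real.pi * I * ((α - β j) / (-2 * Real.pi * I)))) / (2 * Real.pi * I))) *
    gFactor β m α * α ^ d * exp (-α) ^ p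

/-- The points which a contour has to avoid. -/
def poles {n : ℕ} (β : Fin n → ℂ) : Set ℂ :=
  {p | (∃ (j : Fin n) (k : ℕ), p = β j - Real.pi * I + 2 * Real.pi * I * k) ∨
    ∃ (j : Fin n) (k : ℕ), p = β j - 2 * Real.pi * I * k}

/-- The reflection formula, in the form which cancels the zeros of `1 / Γ`. -/
lemma one_div_Gamma_mul_one_sub_exp (z : ℂ) (hz : ∀ k : ℤ, z ≠ k) :
    1 / (Gamma z * (1 - exp (2 * Real.pi * I * z))) =
      Gamma (1 - z) * (-exp (-(Real.pi * I * z)) / (2 * Real.pi * I)) := by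
  have hpi : (Real.pi : ℂ) ≠ 0 := by exact_mod_cast Real.pi_ne_zero
  have hs : sin (Real.pi * z) ≠ 0 := fun h => by
    obtain ⟨k, hk⟩ := sin_eq_zero_iff.1 h
    exact hz k (mul_left_cancel₀ hpi (by rw [hk]; ring))
  have hG : Gamma z ≠ 0 := Gamma_ne_zero fun k e => hz (-k) (by simpa using e)
  have h1 : 1 - exp (2 * Real.pi * I * z) = -(2 * I * exp (Real.pi * I * z) * sin (Real.pi * z)) := by
    rw [sin, show 2 * Real.pi * I * z = Real.pi * I * z + Real.pi * I * z by ring, exp_add,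
      show -(↑Real.pi * z) * I = -(Real.pi * I * z) by ring,
      show ↑Real.pi * z * I = Real.pi * I * z by ring, exp_neg]
    have := exp_ne_zero (Real.pi * I * z)
    field_simp
    linear_combination (1 - cexp (Real.pi * I * z) ^ 2) * I_sq
  have h2 := Gamma_mul_Gamma_one_sub z
  rw [eq_div_iff hs] at h2
  rw [h1, exp_neg]
  have h3 := exp_ne_zero (Real.pi * I * z)
  have h4 := I_ne_zero
  rw [div_eq_iff (by simp [*])]
  field_simp
  simp only [mul_comm z (Real.pi : ℂ)]
  linear_combination -h2

/-- The denominator `1 - A/B_j` vanishes on all of `β_j + 2πiℤ`, but `1/Γ` has zeros at the points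
above and including `β_j`. After reflection only the poles of `Γ(1 - z)`, strictly below `β_j`,
survive. -/
lemma oneVar_eq_oneVarReg {n : ℕ} (β : Fin n → ℂ) (m : Fin n) (d p : ℕ) {α : ℂ}
    (hα : ∀ (j : Fin n) (k : ℤ), α ≠ β j + 2 * Real.pi * I * k) :
    oneVar β m d p α = oneVarReg β m d p α := by
  have key : ∀ j, Gamma ((α - β j + Real.pi * I) / (-2 * Real.pi * I)) /
      Gamma ((α - β j) / (-2 * Real.pi * I)) / (1 - exp (-α) * (expNeg β j)⁻¹) =
      Gamma ((α - β j + Real.pi * I) / (-2 * Real.pi * I)) *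
      Gamma (1 - (α - β j) / (-2 * Real.pi * I)) *
      (-exp (-(Real.pi * I * ((α - β j) / (-2 * Real.pi * I)))) / (2 * Real.pi * I)) := fun j => by
    have h2 := two_pi_I_ne_zero
    have h2' : (-2 * Real.pi * I : ℂ) ≠ 0 := by simp
    have h1 := one_div_Gamma_mul_one_sub_exp ((α - β j) / (-2 * Real.pi * I)) fun k e => by
      rw [div_eq_iff h2'] at e
      exact hα j (-k) (by push_cast; linear_combination e)
    have h3 : exp (2 * Real.pi * I * ((α - β j) / (-2 * Real.pi * I))) =
        exp (-α) * (expNeg β j)⁻¹ := by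
      rw [expNeg, ← exp_neg, ← exp_add]
      congr 1
      have : (-2 * Real.pi * I : ℂ) = -(2 * Real.pi * I) := by ring
      rw [this, div_neg, mul_neg, mul_div_cancel₀ _ h2]
      ring
    rw [mul_assoc (Gamma _), ← h1, ← h3]
    field_simp
  rw [oneVar, oneVarReg, ← Finset.prod_congr rfl fun j _ => key j, Finset.prod_div_distrib, ← phi]
  ring

/-- As `a` is imaginary, the argument has bounded real part on the strip. Enough steps of the
functional equation move it into the right half plane, at the cost of finitely many linear
denominators. -/
lemma stripMero_Gamma {Y : ℝ} {S : Set ℂ} {a b : ℂ} (ha : a ≠ 0) (ha' : a.re = 0)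
    (hS : ∀ k : ℕ, b - k / a ∈ S) : StripMero Y S fun z => Gamma (a * (z - b)) := by
  have key : ∀ K : ℕ, StripMero Y S (fun z => Gamma (a * (z - b) + K)) →
      StripMero Y S fun z => Gamma (a * (z - b)) := by
    intro K
    induction K with
    | zero => simp
    | succ K ih =>
      intro hK
      refine ih (((hK.mul (StripMero.inv_sub (hS K))).mul
        (StripMero.of_differentiableOn (differentiableOn_const a⁻¹))).congr fun z _ hz => ?_)
      have h0 : a * (z - b) + K = a * (z - (b - K / a)) := by field_simp; ring
      have h1 : z - (b - K / a) ≠ 0 := sub_ne_zero.2 fun e => hz (e ▸ hS K)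
      have h2 := Gamma_add_one (a * (z - b) + K) (h0 ▸ mul_ne_zero ha h1)
      rw [Nat.cast_add, Nat.cast_one, ← add_assoc, h2, h0]
      generalize z - (b - K / a) = w at h1
      field_simp
  obtain ⟨K, hK⟩ := exists_nat_gt (|a.im| * (Y + |b.im|))
  refine key K (StripMero.of_differentiableOn fun z hz => ?_)
  have hz' : |z.im| < Y := hz
  have hre : 0 < (a * (z - b) + K).re := by
    simp only [add_re, mul_re, sub_re, sub_im, natCast_re, ha', zero_mul, zero_sub]
    have h1 : |a.im * (z.im - b.im)| ≤ |a.im| * (Y + |b.im|) := by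
      rw [abs_mul]
      gcongr
      exact (abs_sub _ _).trans (by linarith)
    have := le_abs_self (a.im * (z.im - b.im))
    linarith
  refine DifferentiableAt.differentiableWithinAt ?_
  refine (differentiableAt_Gamma _ fun k e => ?_).comp z (by fun_prop)
  rw [e] at hre
  simp at hre
  linarith [Nat.cast_nonneg (α := ℝ) k]

lemma stripMero_gFactor {n : ℕ} (β : Fin n → ℂ) (m : Fin n) (Y : ℝ) :
    StripMero Y (poles β) (gFactor β m) := by
  have h0 : ∀ j, β j ∈ poles β := fun j => Or.inr ⟨j, 0, by simp⟩
  have h1 : gFactor β m = fun α => (α - β m)⁻¹ *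
      ∏ j ∈ Finset.Iio m, (α - β j + Real.pi * I) * (α - β j)⁻¹ := by
    funext α
    simp only [gFactor, div_eq_mul_inv, one_mul]
  rw [h1]
  refine (StripMero.inv_sub (h0 m)).mul (StripMero.prod _ fun j _ => ?_)
  exact (StripMero.of_differentiableOn (by fun_prop)).mul (StripMero.inv_sub (h0 j))

lemma stripMero_oneVarReg {n : ℕ} (β : Fin n → ℂ) (m : Fin n) (d p : ℕ) (Y : ℝ) :
    StripMero Y (poles β) (oneVarReg β m d p) := by
  have h2 := two_pi_I_ne_zero
  have h2' : (-2 * Real.pi * I : ℂ) ≠ 0 := by simp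
  refine (((StripMero.prod _ fun j _ => ((?_ : StripMero Y (poles β) _).mul ?_).mul ?_).mul
    (stripMero_gFactor β m Y)).mul ?_).mul ?_
  · have := stripMero_Gamma (Y := Y) (S := poles β) (a := (-2 * Real.pi * I)⁻¹)
      (b := β j - Real.pi * I) (inv_ne_zero h2') (by simp) fun k => Or.inl ⟨j, k, by
        rw [div_inv_eq_mul]; ring⟩
    refine this.congr fun z _ _ => ?_
    congr 1
    rw [inv_mul_eq_div]; congr 1; ring
  · have := stripMero_Gamma (Y := Y) (S := poles β) (a := (2 * Real.pi * I)⁻¹)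
      (b := β j - 2 * Real.pi * I) (inv_ne_zero h2) (by simp) fun k => Or.inr ⟨j, k + 1, by
        rw [div_inv_eq_mul]; push_cast; ring⟩
    refine this.congr fun z _ _ => ?_
    congr 1
    field_simp
    ring
  · exact StripMero.of_differentiableOn (by fun_prop)
  · exact StripMero.of_differentiableOn (by fun_prop)
  · exact StripMero.of_differentiableOn (by fun_prop)

/-! Asymptotics -/

lemma eventually_lt_abs_re (Y R : ℝ) : ∀ᶠ z in stripEnds Y, R < |z.re| :=
  eventually_stripEnds.2 ⟨R + 1, fun z _ h => by linarith⟩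

lemma eventually_abs_im_lt (Y : ℝ) : ∀ᶠ z in stripEnds Y, |z.im| < Y :=
  eventually_stripEnds.2 ⟨0, fun _ h _ => h⟩

lemma isBigO_inv_sub (Y : ℝ) (b : ℂ) :
    (fun z => (z - b)⁻¹) =O[stripEnds Y] fun z => z⁻¹ := by
  refine IsBigO.of_bound 2 ?_
  filter_upwards [eventually_lt_abs_re Y (2 * ‖b‖)] with z hz
  have h1 : 2 * ‖b‖ < ‖z‖ := hz.trans_le (abs_re_le_norm z)
  have h2 : ‖z‖ ≤ ‖z - b‖ + ‖b‖ := by simpa using norm_add_le (z - b) b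
  have h3 := norm_nonneg b
  rw [norm_inv, norm_inv, ← div_eq_mul_inv, inv_eq_one_div,
    div_le_div_iff₀ (by linarith) (by linarith)]
  linarith

lemma isBigO_inv_one (Y : ℝ) : (fun z : ℂ => z⁻¹) =O[stripEnds Y] fun _ => (1 : ℂ) := by
  have := (tendsto_inv_sub_stripEnds Y 0).isBigO_one ℂ
  simpa using this

lemma isBigO_Gamma_div_sq (Y : ℝ) (b : ℂ) :
    (fun α => (Gamma ((α - b + Real.pi * I) / (-2 * Real.pi * I)) /
      Gamma ((α - b) / (-2 * Real.pi * I))) ^ 2) =O[stripEnds Y] fun α => α⁻¹ := by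
  have h2 := two_pi_I_ne_zero
  obtain ⟨C, hC, h⟩ := exists_norm_Gamma_div_sq_le ((Y + |b.im|) / (2 * Real.pi))
  have h1 : (fun α => (Gamma ((α - b + Real.pi * I) / (-2 * Real.pi * I)) /
      Gamma ((α - b) / (-2 * Real.pi * I))) ^ 2) =O[stripEnds Y]
      fun α => (-2 * Real.pi * I) * (α - b)⁻¹ := by
    refine IsBigO.of_bound C ?_
    filter_upwards [eventually_lt_abs_re Y (|b.re| + 2 * Real.pi), eventually_abs_im_lt Y]
      with α hre him
    have hpi := Real.pi_pos
    set z := (α - b) / (-2 * Real.pi * I) with hz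
    have e1 : (α - b + Real.pi * I) / (-2 * Real.pi * I) = z - 1 / 2 := by
      rw [hz]
      have : (Real.pi : ℂ) ≠ 0 := by exact_mod_cast hpi.ne'
      have := I_ne_zero
      field_simp
      ring
    have e2 : z = (α - b) * I * ((1 / (2 * Real.pi) : ℝ) : ℂ) := by
      rw [hz, div_eq_iff (by simp)]
      have : (Real.pi : ℂ) ≠ 0 := by exact_mod_cast hpi.ne'
      push_cast
      field_simp
      linear_combination (α - b) * I_sq
    have e3 : z.re = -(α - b).im / (2 * Real.pi) := by
      rw [e2, re_mul_ofReal, mul_I_re]; ring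
    have e4 : z.im = (α - b).re / (2 * Real.pi) := by
      rw [e2, im_mul_ofReal, mul_I_im]; ring
    rw [e1]
    refine (h z ?_ ?_).trans_eq ?_
    · rw [e3, abs_div, abs_neg, abs_of_pos (by positivity : 0 < 2 * Real.pi)]
      gcongr
      rw [sub_im]
      exact (abs_sub _ _).trans (by linarith)
    · rw [e4, abs_div, abs_of_pos (by positivity : 0 < 2 * Real.pi), le_div_iff₀ (by positivity),
        sub_re]
      have := abs_sub_abs_le_abs_sub α.re b.re
      linarith
    · rw [hz, ← norm_inv, inv_div, div_eq_mul_inv]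
  exact h1.trans ((isBigO_inv_sub Y b).const_mul_left _)

lemma isBigO_phi_sq {n : ℕ} (β : Fin n → ℂ) (Y : ℝ) :
    (fun α => phi β α ^ 2) =O[stripEnds Y] fun α => α⁻¹ ^ n := by
  have := IsBigO.finsetProd (s := Finset.univ) fun j _ => isBigO_Gamma_div_sq Y (β j)
  simpa [phi, Finset.prod_pow] using this

lemma isBigO_gFactor {n : ℕ} (β : Fin n → ℂ) (m : Fin n) (Y : ℝ) :
    gFactor β m =O[stripEnds Y] fun α => α⁻¹ := by
  have h1 : ∀ j, (fun α => (α - β j + Real.pi * I) / (α - β j)) =O[stripEnds Y]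
      fun _ => (1 : ℂ) := fun j => by
    have h2 := ((((isBigO_inv_sub Y (β j)).trans (isBigO_inv_one Y)).const_mul_left
      (Real.pi * I)).add (isBigO_refl (fun _ => (1 : ℂ)) (stripEnds Y)))
    refine h2.congr' ?_ EventuallyEq.rfl
    filter_upwards [stripEnds_le_cobounded Y (Bornology.eventually_ne_cobounded (β j))] with z hz
    have := sub_ne_zero.2 hz
    field_simp
    ring
  have h3 := IsBigO.finsetProd (s := Finset.Iio m) fun j _ => h1 j
  have h4 := (isBigO_inv_sub Y (β m)).mul h3
  refine h4.congr (fun α => ?_) fun α => by simp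
  rw [gFactor, one_div]

lemma exists_norm_inv_exp_sub_le (b : ℂ) (hb : b ≠ 0) (σ : ℝ) (hσ : |σ| = 1) :
    ∃ R : ℝ, ∀ z : ℂ, R ≤ |z.re| → ‖(exp (σ * z) - b)⁻¹‖ ≤ 2 / ‖b‖ := by
  have hb' : 0 < ‖b‖ := norm_pos_iff.2 hb
  refine ⟨|Real.log (2 * ‖b‖)| + |Real.log (‖b‖ / 2)|, fun z hz => ?_⟩
  have h0 : ‖exp (σ * z)‖ = Real.exp (σ * z.re) := by rw [norm_exp]; simp
  have h1 : ‖b‖ / 2 ≤ ‖exp (σ * z) - b‖ := by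
    have h2 := abs_norm_sub_norm_le (exp (σ * z)) b
    rw [h0] at h2
    refine le_trans ?_ h2
    have h3 : |σ * z.re| = |z.re| := by rw [abs_mul, hσ, one_mul]
    rw [← h3] at hz
    have h4 := abs_nonneg (Real.log (2 * ‖b‖))
    have h5 := abs_nonneg (Real.log (‖b‖ / 2))
    rcases le_total 0 (σ * z.re) with hs | hs
    · rw [abs_of_nonneg hs] at hz
      have : 2 * ‖b‖ ≤ Real.exp (σ * z.re) := by
        rw [← Real.log_le_iff_le_exp (by positivity)]
        linarith [le_abs_self (Real.log (2 * ‖b‖))]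
      exact le_trans (by linarith) (le_abs_self _)
    · rw [abs_of_nonpos hs] at hz
      have : Real.exp (σ * z.re) ≤ ‖b‖ / 2 := by
        rw [← Real.le_log_iff_exp_le (by positivity)]
        linarith [neg_abs_le (Real.log (‖b‖ / 2))]
      exact le_trans (by linarith) (neg_le_abs _)
  rw [norm_inv, ← one_div, div_le_div_iff₀ (by linarith) hb']
  linarith

lemma isBigO_inv_exp_sub (Y : ℝ) (b : ℂ) (hb : b ≠ 0) (σ : ℝ) (hσ : |σ| = 1) :
    (fun z : ℂ => (exp (σ * z) - b)⁻¹) =O[stripEnds Y] fun _ => (1 : ℂ) := by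
  obtain ⟨R, hR⟩ := exists_norm_inv_exp_sub_le b hb σ hσ
  refine IsBigO.of_bound (2 / ‖b‖) ?_
  filter_upwards [eventually_lt_abs_re Y R] with z hz
  simpa using hR z hz.le

/-- Since `p ≤ n`, each numerator factor `e^{-α}` can be paired with its own denominator. Both
`e^{-α}/(1 - e^{-α}/B)` and `1/(1 - e^{-α}/B)` stay bounded at both ends. -/
lemma isBigO_exp_pow_div {n : ℕ} (β : Fin n → ℂ) {p : ℕ} (hp : p ≤ n) (Y : ℝ) :
    (fun α => exp (-α) ^ p / ∏ j, (1 - exp (-α) * (expNeg β j)⁻¹)) =O[stripEnds Y]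
      fun _ => (1 : ℂ) := by
  have h1 : ∀ j : Fin n, (fun α => (if (j : ℕ) < p then exp (-α) else 1) *
      (1 - exp (-α) * (expNeg β j)⁻¹)⁻¹) =O[stripEnds Y] fun _ => (1 : ℂ) := fun j => by
    have hb : expNeg β j ≠ 0 := exp_ne_zero _
    split_ifs
    · refine (isBigO_inv_exp_sub Y (expNeg β j)⁻¹ (inv_ne_zero hb) 1 (by simp)).congr_left
        fun z => ?_
      have := exp_ne_zero z
      rw [ofReal_one, one_mul, exp_neg, ← inv_inv (cexp z)⁻¹, ← mul_inv, inv_inv]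
      congr 1
      field_simp
    · refine ((isBigO_inv_exp_sub Y (expNeg β j) hb (-1) (by simp)).const_mul_left
        (-(expNeg β j))).congr_left fun z => ?_
      rw [ofReal_neg, ofReal_one, neg_one_mul, one_mul,
        show 1 - cexp (-z) * (expNeg β j)⁻¹ = (cexp (-z) - expNeg β j) * (-(expNeg β j))⁻¹ by
          field_simp; ring, mul_inv, inv_inv, mul_comm]
  have h2 := IsBigO.finsetProd (s := Finset.univ) fun j _ => h1 j
  refine h2.congr (fun α => ?_) fun α => by simp
  rw [Finset.prod_mul_distrib, Finset.prod_ite, Finset.prod_const_one, mul_one, Finset.prod_const,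
    Finset.prod_inv_distrib, div_eq_mul_inv]
  congr 2
  rw [Fin.card_filter_val_lt]
  omega

/-- The squares are compared, since the Gamma estimate is for `φ²`: the exponents add up to `-n - 2
+ 2d ≤ -4`. -/
lemma isBigO_oneVar {n : ℕ} (β : Fin n → ℂ) (m : Fin n) {d p : ℕ} (hd : 2 * d + 2 ≤ n)
    (hp : p ≤ n) (Y : ℝ) : oneVar β m d p =O[stripEnds Y] fun α => α⁻¹ ^ 2 := by
  refine IsBigO.of_pow two_ne_zero ?_
  have h1 := (((isBigO_phi_sq β Y).mul ((isBigO_gFactor β m Y).pow 2)).mul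
    (isBigO_refl (fun α : ℂ => (α ^ d) ^ 2) (stripEnds Y))).mul ((isBigO_exp_pow_div β hp Y).pow 2)
  have h2 : (fun α : ℂ => α⁻¹ ^ n * α⁻¹ ^ 2 * (α ^ d) ^ 2 * 1 ^ 2) =O[stripEnds Y]
      fun α => (α⁻¹ ^ 2) ^ 2 := by
    have h3 := ((isBigO_inv_one Y).pow (n - (2 * d + 2))).mul
      (isBigO_refl (fun α : ℂ => (α⁻¹ ^ 2) ^ 2) (stripEnds Y))
    refine h3.congr' ?_ (by simp)
    filter_upwards [stripEnds_le_cobounded Y (Bornology.eventually_ne_cobounded 0)] with z hz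
    obtain ⟨e, rfl⟩ := Nat.exists_eq_add_of_le hd
    have h4 : z⁻¹ ^ d * z ^ d = 1 := by rw [← mul_pow, inv_mul_cancel₀ hz, one_pow]
    rw [Nat.add_sub_cancel_left]
    linear_combination -(z⁻¹ ^ e * z⁻¹ ^ 4 * (z⁻¹ ^ d * z ^ d + 1)) * h4
  exact (h1.congr_left fun α => by simp only [oneVar, Pi.pow_apply]; ring).trans h2

lemma isBigO_inv_sq_of_eventually_eq {γ : ℝ → ℂ} {l : Filter ℝ} (hl : Tendsto (|·|) l atTop) {c : ℂ}
    (hc : ∀ᶠ t in l, γ t = (t : ℂ) + c) :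
    (fun t => (γ t)⁻¹ ^ 2) =O[l] fun t : ℝ => (1 + t ^ 2)⁻¹ := by
  refine IsBigO.of_bound 8 ?_
  filter_upwards [hc, hl.eventually (eventually_ge_atTop (2 * ‖c‖ + 1))] with t ht hct
  have h1 : |t| ≤ ‖γ t‖ + ‖c‖ := by
    have := norm_sub_le (γ t) c
    rwa [ht, add_sub_cancel_right, norm_real, Real.norm_eq_abs, ← ht] at this
  have h2 := norm_nonneg c
  have h3 : |t| / 2 ≤ ‖γ t‖ := by linarith
  have h4 : 1 ≤ |t| := by linarith
  have h5 : t ^ 2 = |t| ^ 2 := (sq_abs t).symm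
  rw [norm_pow, norm_inv, inv_pow, norm_inv, Real.norm_of_nonneg (by positivity), ← div_eq_mul_inv,
    inv_eq_one_div, div_le_div_iff₀ (by nlinarith) (by positivity)]
  nlinarith

lemma HorizontalEnds.integrable {γ : ℝ → ℂ} (h : HorizontalEnds γ) {Y : ℝ}
    (hY : ∀ t, γ t ∈ strip Y) {f : ℂ → ℂ} (hc : Continuous fun t => f (γ t))
    (hf : f =O[stripEnds Y] fun z => z⁻¹ ^ 2) : Integrable fun t => deriv γ t * f (γ t) := by
  have hd : ∀ {s : Set ℝ} {c : ℂ}, IsOpen s → (∀ t ∈ s, γ t = (t : ℂ) + c) →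
      ∀ t ∈ s, deriv γ t = 1 := fun {s c} hs he t ht => by
    have h1 : γ =ᶠ[𝓝 t] fun t : ℝ => (t : ℂ) + c := by
      filter_upwards [hs.mem_nhds ht] with x hx using he x hx
    rw [h1.deriv_eq]
    exact ((hasDerivAt_id t).ofReal_comp.add_const c).deriv
  have key : ∀ {l : Filter ℝ}, Tendsto γ l (stripEnds Y) → Tendsto (|·|) l atTop →
      (∃ c : ℂ, ∀ᶠ t in l, γ t = (t : ℂ) + c) → (∀ᶠ t in l, deriv γ t = 1) →
      (fun t => deriv γ t * f (γ t)) =O[l] fun t : ℝ => (1 + t ^ 2)⁻¹ := by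
    rintro l hl habs ⟨c, hc⟩ hd
    refine ((hf.comp_tendsto hl).trans (isBigO_inv_sq_of_eventually_eq habs hc)).congr' ?_
      EventuallyEq.rfl
    filter_upwards [hd] with t ht
    simp [ht]
  have hint : ∀ l : Filter ℝ, IntegrableAtFilter (fun t : ℝ => (1 + t ^ 2)⁻¹) l := fun l =>
    integrable_inv_one_add_sq.integrableAtFilter l
  refine (h.continuous_deriv.mul hc).locallyIntegrable.integrable_of_isBigO_atBot_atTop
    (key (h.tendsto_stripEnds_left hY) tendsto_abs_atBot_atTop h.left_end ?_) (hint _)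
    (key (h.tendsto_stripEnds_right hY) tendsto_abs_atTop_atTop h.right_end ?_) (hint _)
  · obtain ⟨c, hc⟩ := h.left_end
    obtain ⟨T, hT⟩ := eventually_atBot.1 hc
    filter_upwards [eventually_lt_atBot T] with t ht
    exact hd isOpen_Iio (fun t ht => hT t (le_of_lt ht)) t ht
  · obtain ⟨c, hc⟩ := h.right_end
    obtain ⟨T, hT⟩ := eventually_atTop.1 hc
    filter_upwards [eventually_gt_atTop T] with t ht
    exact hd isOpen_Ioi (fun t ht => hT t (le_of_lt ht)) t ht

lemma tendsto_inv_sq_stripEnds (Y : ℝ) : Tendsto (fun z : ℂ => z⁻¹ ^ 2) (stripEnds Y) (𝓝 0) := by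
  simpa using (tendsto_inv_sub_stripEnds Y 0).pow 2

/-! ### Convergence and contour independence in one variable. -/

section

variable {n : ℕ} {β : Fin n → ℂ}

lemma eventually_re_ne (β : Fin n → ℂ) (Y : ℝ) : ∀ᶠ z in stripEnds Y, ∀ j, z.re ≠ (β j).re := by
  refine eventually_all.2 fun j => ?_
  filter_upwards [eventually_lt_abs_re Y |(β j).re|] with z hz e
  rw [e] at hz
  exact lt_irrefl _ hz

lemma eventually_notMem_poles (β : Fin n → ℂ) (Y : ℝ) : ∀ᶠ z in stripEnds Y, z ∉ poles β := by
  filter_upwards [eventually_re_ne β Y] with z hz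
  rintro (⟨j, k, rfl⟩ | ⟨j, k, rfl⟩) <;> exact hz j (by simp)

lemma oneVar_eventuallyEq (β : Fin n → ℂ) (m : Fin n) (d p : ℕ) (Y : ℝ) :
    oneVar β m d p =ᶠ[stripEnds Y] oneVarReg β m d p := by
  filter_upwards [eventually_re_ne β Y] with z hz
  exact oneVar_eq_oneVarReg β m d p fun j k e => hz j (by simp [e])

lemma isBigO_oneVarReg (β : Fin n → ℂ) (m : Fin n) {d p : ℕ} (hd : 2 * d + 2 ≤ n)
    (hp : p ≤ n) (Y : ℝ) : oneVarReg β m d p =O[stripEnds Y] fun α => α⁻¹ ^ 2 :=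
  (isBigO_oneVar β m hd hp Y).congr' (oneVar_eventuallyEq β m d p Y) EventuallyEq.rfl

namespace IsContour

variable {γ : ℝ → ℂ} (h : IsContour β γ)
include h

lemma notMem_poles (t : ℝ) : γ t ∉ poles β := fun ht => (h.sameSide h ht).ne₁ t rfl

/-- A contour may run through removable singularities `β_j + 2πik`, where `oneVar` takes default
values of division. By injectivity it does so at countably many parameters only. -/
lemma oneVar_ae_eq (m : Fin n) (d p : ℕ) :
    (fun t => deriv γ t * oneVar β m d p (γ t)) =ᵐ[volume]
      fun t => deriv γ t * oneVarReg β m d p (γ t) := by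
  have hcount : (γ ⁻¹' (Set.range fun x : Fin n × ℤ => β x.1 + 2 * Real.pi * I * x.2)).Countable :=
    (Set.countable_range _).preimage_of_injOn h.injective.injOn
  filter_upwards [hcount.ae_notMem volume] with t ht
  rw [oneVar_eq_oneVarReg]
  exact fun j k e => ht ⟨(j, k), e.symm⟩

lemma integrable_oneVarReg (m : Fin n) {d p : ℕ} (hd : 2 * d + 2 ≤ n) (hp : p ≤ n) :
    Integrable fun t => deriv γ t * oneVarReg β m d p (γ t) := by
  obtain ⟨Y, -, hY⟩ := h.horizontalEnds.exists_strip
  exact h.horizontalEnds.integrable hY ((stripMero_oneVarReg β m d p Y).continuous_comp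
    h.horizontalEnds.continuous hY h.notMem_poles) (isBigO_oneVarReg β m hd hp Y)

lemma integrable_oneVar (m : Fin n) {d p : ℕ} (hd : 2 * d + 2 ≤ n) (hp : p ≤ n) :
    Integrable fun t => deriv γ t * oneVar β m d p (γ t) :=
  (h.integrable_oneVarReg m hd hp).congr (h.oneVar_ae_eq m d p).symm

lemma integral_oneVar_eq {γ' : ℝ → ℂ} (h' : IsContour β γ') (m : Fin n) {d p : ℕ}
    (hd : 2 * d + 2 ≤ n) (hp : p ≤ n) :
    ∫ t, deriv γ t * oneVar β m d p (γ t) = ∫ t, deriv γ' t * oneVar β m d p (γ' t) := by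
  rw [integral_congr_ae (h.oneVar_ae_eq m d p), integral_congr_ae (h'.oneVar_ae_eq m d p)]
  obtain ⟨Y₁, -, hY₁⟩ := h.horizontalEnds.exists_strip
  obtain ⟨Y₂, -, hY₂⟩ := h'.horizontalEnds.exists_strip
  have h1 := (stripMero_oneVarReg β m d p (max Y₁ Y₂)).loopNull h.horizontalEnds h'.horizontalEnds
    (fun t => lt_of_lt_of_le (show |(γ t).im| < Y₁ from hY₁ t) (le_max_left _ _))
    (fun t => lt_of_lt_of_le (show |(γ' t).im| < Y₂ from hY₂ t) (le_max_right _ _)) (fun _ hp => h.sameSide h' hp)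
    (eventually_notMem_poles β _)
    ((isBigO_oneVarReg β m hd hp _).trans_tendsto (tendsto_inv_sq_stripEnds _))
  have h2 := intervalIntegral_tendsto_integral (h.integrable_oneVarReg m hd hp)
    tendsto_neg_atTop_atBot tendsto_id
  have h3 := intervalIntegral_tendsto_integral (h'.integrable_oneVarReg m hd hp)
    tendsto_neg_atTop_atBot tendsto_id
  exact sub_eq_zero.1 (tendsto_nhds_unique (h2.sub h3) h1)

end IsContour

end

/-! Reduction of the integrals to one variable -/

open MvPolynomial in
/-- The polynomial `∏_{a<b} (α_{σ a} - α_{σ b} + πi)`. -/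
def diffPoly {ℓ : ℕ} (σ : Equiv.Perm (Fin ℓ)) : MvPolynomial (Fin ℓ) ℂ :=
  ∏ a, ∏ b ∈ Finset.Ioi a, (X (σ a) - X (σ b) + C (Real.pi * I))

/-- Each variable occurs in `ℓ - 1` of the linear factors, once for every other variable. -/
lemma degreeOf_diffPoly_le {ℓ : ℕ} (σ : Equiv.Perm (Fin ℓ)) (c : Fin ℓ) :
    (diffPoly σ).degreeOf c ≤ ℓ - 1 := by
  have h1 : ∀ a b : Fin ℓ, (MvPolynomial.X (σ a) - MvPolynomial.X (σ b) +
      MvPolynomial.C (Real.pi * I : ℂ) : MvPolynomial (Fin ℓ) ℂ).degreeOf c ≤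
      (if a = σ.symm c then 1 else 0) + if b = σ.symm c then 1 else 0 := fun a b => by
    refine (MvPolynomial.degreeOf_add_le _ _ _).trans ?_
    rw [MvPolynomial.degreeOf_C, max_eq_left (Nat.zero_le _)]
    refine (MvPolynomial.degreeOf_sub_le _ _ _).trans ?_
    rw [MvPolynomial.degreeOf_X, MvPolynomial.degreeOf_X]
    simp only [Equiv.eq_symm_apply, eq_comm (a := c)]
    split_ifs <;> simp
  refine (MvPolynomial.degreeOf_prod_le _ _ _).trans ((Finset.sum_le_sum fun a _ =>
    (MvPolynomial.degreeOf_prod_le _ _ _).trans (Finset.sum_le_sum fun b _ => h1 a b)).trans ?_)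
  simp only [Finset.sum_add_distrib, Finset.sum_const, smul_eq_mul, mul_ite, mul_one, mul_zero,
    Finset.sum_ite_eq', Finset.mem_univ, if_true, Finset.mem_Ioi, Fin.card_Ioi]
  rw [← Finset.card_filter]
  have : (Finset.univ.filter fun a => a < σ.symm c) = Finset.Iio (σ.symm c) := by
    ext; simp
  rw [this, Fin.card_Iio]
  omega

lemma gM_comp_perm {n ℓ : ℕ} (β : Fin n → ℂ) (M : Finset (Fin n)) (hM : M.card = ℓ)
    (α : Fin ℓ → ℂ) (σ : Equiv.Perm (Fin ℓ)) :
    gM β M hM (fun a => α (σ a)) =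
      (∏ a, gFactor β (M.orderEmbOfFin hM (σ.symm a)) (α a)) * (diffPoly σ).eval α := by
  rw [gM, diffPoly, map_prod]
  simp only [map_prod, map_add, map_sub, MvPolynomial.eval_X, MvPolynomial.eval_C]
  congr 1
  rw [← Equiv.prod_comp σ fun a => gFactor β (M.orderEmbOfFin hM (σ.symm a)) (α a)]
  simp only [Equiv.symm_apply_apply, gFactor]

/-- The only coupling between the variables is polynomial, in the `α_a` through `diffPoly` and in
the `A_a` through `Q`; monomial by monomial the integrand is a product, to which Fubini applies. -/
lemma pullback_integrand_eq {n ℓ : ℕ} {P : (Fin ℓ → ℂ) → (Fin n → ℂ) → ℂ} {β : Fin n → ℂ}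
    {Q : MvPolynomial (Fin ℓ) ℂ} (hQ : ∀ A, P A (expNeg β) = Q.eval A)
    (M : Finset (Fin n)) (hM : M.card = ℓ) (γ : ℝ → ℂ) :
    pullback γ (integrand P β M hM) = fun t => ∑ σ : Equiv.Perm (Fin ℓ),
      ∑ u ∈ (diffPoly σ).support, ∑ v ∈ Q.support,
        ((Equiv.Perm.sign σ : ℤ) : ℂ) * (diffPoly σ).coeff u * Q.coeff v *
        ∏ a, (deriv γ (t a) *
          oneVar β (M.orderEmbOfFin hM (σ.symm a)) (u a) (v a) (γ (t a))) := by
  funext t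
  have h1 : ∀ α : Fin ℓ → ℂ, wM β M hM α = ∑ σ : Equiv.Perm (Fin ℓ),
      ((Equiv.Perm.sign σ : ℤ) : ℂ) * ((∏ a, gFactor β (M.orderEmbOfFin hM (σ.symm a)) (α a)) *
        (diffPoly σ).eval α) := fun α => Finset.sum_congr rfl fun σ _ => by rw [gM_comp_perm]
  simp only [pullback, integrand, h1, cycleFn, hQ, Finset.mul_sum, Finset.sum_mul]
  refine Finset.sum_congr rfl fun σ _ => ?_
  simp only [MvPolynomial.eval_eq', Finset.mul_sum, Finset.sum_mul, Finset.sum_div]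
  rw [Finset.sum_comm]
  refine Finset.sum_congr rfl fun u _ => Finset.sum_congr rfl fun v _ => ?_
  simp only [oneVar, Finset.prod_mul_distrib, Finset.prod_div_distrib, expNeg]
  ring

section

variable {n ℓ : ℕ} {P : (Fin ℓ → ℂ) → (Fin n → ℂ) → ℂ} {β : Fin n → ℂ}
  {Q : MvPolynomial (Fin ℓ) ℂ} (hQ : ∀ A, P A (expNeg β) = Q.eval A)
  (hℓ : Q ≠ 0 → 2 * ℓ ≤ n) (hdeg : ∀ a, Q.degreeOf a ≤ n) {γ : ℝ → ℂ} (h : IsContour β γ)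

-- The bound on `ℓ` is required only for `Q ≠ 0`: if `n < m` the cycle is zero, while `ℓ = r` may
-- exceed `n/2`.
include hℓ hdeg in
lemma degree_bounds {σ : Equiv.Perm (Fin ℓ)} {u v : Fin ℓ →₀ ℕ} (hu : u ∈ (diffPoly σ).support)
    (hv : v ∈ Q.support) (a : Fin ℓ) : 2 * u a + 2 ≤ n ∧ v a ≤ n := by
  have h1 := (MvPolynomial.monomial_le_degreeOf a hu).trans (degreeOf_diffPoly_le σ a)
  have h2 := (MvPolynomial.monomial_le_degreeOf a hv).trans (hdeg a)
  have h3 := hℓ fun e => by simp [e] at hv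
  have := a.2
  omega

include hQ hℓ hdeg h

omit hQ in
lemma integrable_term (M : Finset (Fin n)) (hM : M.card = ℓ) (σ : Equiv.Perm (Fin ℓ))
    {u v : Fin ℓ →₀ ℕ} (hu : u ∈ (diffPoly σ).support) (hv : v ∈ Q.support) (c : ℂ) :
    Integrable fun t : Fin ℓ → ℝ => c * ∏ a, (deriv γ (t a) *
      oneVar β (M.orderEmbOfFin hM (σ.symm a)) (u a) (v a) (γ (t a))) := by
  refine Integrable.const_mul ?_ _
  refine Integrable.fintype_prod (f := fun a t => deriv γ t * oneVar β
    (M.orderEmbOfFin hM (σ.symm a)) (u a) (v a) (γ t)) fun a => ?_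
  have := degree_bounds hℓ hdeg hu hv a
  exact h.integrable_oneVar _ this.1 this.2

lemma integrable_pullback (M : Finset (Fin n)) (hM : M.card = ℓ) :
    Integrable (pullback γ (integrand P β M hM)) := by
  rw [pullback_integrand_eq hQ]
  exact integrable_finsetSum _ fun σ _ => integrable_finsetSum _ fun u hu =>
    integrable_finsetSum _ fun v hv => integrable_term hℓ hdeg h M hM σ hu hv _

lemma integral_pullback (M : Finset (Fin n)) (hM : M.card = ℓ) :
    ∫ t, pullback γ (integrand P β M hM) t = ∑ σ : Equiv.Perm (Fin ℓ),
      ∑ u ∈ (diffPoly σ).support, ∑ v ∈ Q.support,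
        ((Equiv.Perm.sign σ : ℤ) : ℂ) * (diffPoly σ).coeff u * Q.coeff v *
        ∏ a, ∫ t, deriv γ t *
          oneVar β (M.orderEmbOfFin hM (σ.symm a)) (u a) (v a) (γ t) := by
  have hint := fun σ u hu v hv => integrable_term hℓ hdeg h M hM σ (u := u) (v := v) hu hv
  rw [pullback_integrand_eq hQ, integral_finsetSum _ fun σ _ => integrable_finsetSum _ fun u hu =>
    integrable_finsetSum _ fun v hv => hint σ u hu v hv _]
  refine Finset.sum_congr rfl fun σ _ => ?_
  rw [integral_finsetSum _ fun u hu => integrable_finsetSum _ fun v hv => hint σ u hu v hv _]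
  refine Finset.sum_congr rfl fun u hu => ?_
  rw [integral_finsetSum _ fun v hv => hint σ u hu v hv _]
  refine Finset.sum_congr rfl fun v _ => ?_
  rw [integral_const_mul, integral_fintype_prod_volume_eq_prod (fun a t => deriv γ t * oneVar β
    (M.orderEmbOfFin hM (σ.symm a)) (u a) (v a) (γ t))]

lemma formFactorAlong_eq {γ' : ℝ → ℂ} (h' : IsContour β γ') :
    formFactorAlong P β γ = formFactorAlong P β γ' := by
  simp only [formFactorAlong, PsiAlong]
  congr 1
  refine Finset.sum_congr rfl fun M _ => ?_
  rw [integral_pullback hQ hℓ hdeg h, integral_pullback hQ hℓ hdeg h']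
  congr 1
  refine Finset.sum_congr rfl fun σ _ => Finset.sum_congr rfl fun u hu =>
    Finset.sum_congr rfl fun v hv => ?_
  congr 1
  refine Finset.prod_congr rfl fun a _ => ?_
  have := degree_bounds hℓ hdeg hu hv a
  exact h.integral_oneVar_eq h' _ this.1 this.2

end

/-- Form factors of polynomial cycles are well defined. -/
lemma wellDefined_of_polynomial {ℓ : ℕ → ℕ} {P : ∀ n : ℕ, (Fin (ℓ n) → ℂ) → (Fin n → ℂ) → ℂ}
    (hP : ∀ n, Even n → ∀ B : Fin n → ℂ, ∃ Q : MvPolynomial (Fin (ℓ n)) ℂ,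
      (∀ A, P n A B = Q.eval A) ∧ (Q ≠ 0 → 2 * ℓ n ≤ n) ∧ ∀ a, Q.degreeOf a ≤ n) :
    WellDefined P := by
  intro n hn β _ γ hγ
  obtain ⟨Q, hQ, hℓ, hdeg⟩ := hP n hn (expNeg β)
  refine ⟨fun M hM => integrable_pullback hQ hℓ hdeg hγ M hM, ?_⟩
  have hex : ∃ γ : ℝ → ℂ, IsContour β γ := ⟨γ, hγ⟩
  rw [formFactor, dif_pos hex]
  exact formFactorAlong_eq hQ hℓ hdeg hex.choose_spec hγ

/-! The cycles are polynomials in the `A_a` -/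

open MvPolynomial in
lemma degreeOf_det_le {κ : Type*} {n : ℕ} (N : Matrix (Fin n) (Fin n) (MvPolynomial κ ℂ)) (c : κ)
    (e : Fin n → ℕ) (h : ∀ i j, (N i j).degreeOf c ≤ e i) : N.det.degreeOf c ≤ ∑ i, e i := by
  classical
  rw [Matrix.det_apply']
  refine (degreeOf_sum_le _ _ _).trans (Finset.sup_le fun σ _ => ?_)
  have h1 : (((Equiv.Perm.sign σ : ℤ) : MvPolynomial κ ℂ)) = C ((Equiv.Perm.sign σ : ℤ) : ℂ) := by
    simp
  rw [h1]
  refine (degreeOf_C_mul_le _ _ _).trans ((degreeOf_prod_le _ _ _).trans ?_)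
  rw [← Equiv.sum_comp σ e]
  exact Finset.sum_le_sum fun i _ => h _ _

open MvPolynomial in
-- Only the last `n - (n+m)/2` rows involve the `A_a`, each quadratically in every one of the first
-- `r`.
lemma exists_polynomial_Ddet {r q n : ℕ} (ε : ℤˣ) (m : ℕ) (B : Fin n → ℂ) :
    ∃ Q : MvPolynomial (Fin (r + q)) ℂ,
      (∀ A, Ddet ε m 0 (fun a : Fin r => A (Fin.castAdd q a)) B = Q.eval A) ∧
      (∀ a : Fin r, Q.degreeOf (Fin.castAdd q a) ≤ 2 * (n - (n + m) / 2)) ∧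
      ∀ b : Fin q, Q.degreeOf (Fin.natAdd r b) = 0 := by
  classical
  set N : Matrix (Fin n) (Fin n) (MvPolynomial (Fin (r + q)) ℂ) := Matrix.of fun i j =>
    if (i : ℕ) < (n + m) / 2 then C (B j ^ ((ε : ℤ) * (2 * ((i : ℕ) : ℤ))))
    else C (B j ^ ((ε : ℤ) * (2 * (((i : ℕ) - (n + m) / 2 + 1 : ℕ) : ℤ) - 1))) *
      ∏ a : Fin r, (1 - X (Fin.castAdd q a) ^ 2 * C (B j ^ (-2 : ℤ))) with hN
  set z : ℂ := (∏ j, ∏ j' ∈ Finset.Ioi j, (B j ^ (ε : ℤ) - B j' ^ (ε : ℤ)))⁻¹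
  have hdeg : ∀ (c : Fin (r + q)) (D : ℕ), (∀ (j : Fin n), ∑ a : Fin r,
      (1 - X (Fin.castAdd q a) ^ 2 * C (B j ^ (-2 : ℤ)) :
        MvPolynomial (Fin (r + q)) ℂ).degreeOf c ≤ D) →
      (C z * N.det).degreeOf c ≤ D * (n - (n + m) / 2) := fun c D hD => by
    refine (degreeOf_C_mul_le _ _ _).trans ((degreeOf_det_le N c
      (fun i => if (i : ℕ) < (n + m) / 2 then 0 else D) fun i j => ?_).trans ?_)
    · rw [hN, Matrix.of_apply]
      split_ifs
      · rw [degreeOf_C]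
      · exact (degreeOf_C_mul_le _ _ _).trans ((degreeOf_prod_le _ _ _).trans (hD j))
    · rw [Finset.sum_ite, Finset.sum_const_zero, zero_add, Finset.sum_const, smul_eq_mul, mul_comm]
      refine Nat.mul_le_mul_left _ ?_
      have h1 := Finset.card_filter_add_card_filter_not (s := (Finset.univ : Finset (Fin n)))
        (fun i : Fin n => (i : ℕ) < (n + m) / 2)
      rw [Fin.card_filter_val_lt, Finset.card_univ, Fintype.card_fin] at h1
      omega
  have hfac : ∀ (c : Fin (r + q)) (j : Fin n) (a : Fin r),
      (1 - X (Fin.castAdd q a) ^ 2 * C (B j ^ (-2 : ℤ)) :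
        MvPolynomial (Fin (r + q)) ℂ).degreeOf c ≤ if c = Fin.castAdd q a then 2 else 0 :=
    fun c j a => by
      refine (degreeOf_sub_le _ _ _).trans ?_
      rw [degreeOf_one, max_eq_right (Nat.zero_le _)]
      refine (degreeOf_mul_C_le _ _ _).trans ((degreeOf_pow_le _ _ _).trans ?_)
      rw [degreeOf_X]
      split_ifs <;> simp
  refine ⟨C z * N.det, fun A => ?_, fun a => ?_, fun b => ?_⟩
  · rw [map_mul, eval_C, RingHom.map_det, Ddet, div_eq_mul_inv, mul_comm]
    congr 2
    ext i j
    simp only [hN, Matrix.of_apply, RingHom.mapMatrix_apply, Matrix.map_apply]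
    split_ifs
    · simp
    · simp [Hp]
  · refine hdeg _ 2 fun j => (Finset.sum_le_sum fun a' _ => hfac _ j a').trans ?_
    simp [Fin.castAdd_inj]
  · refine Nat.le_zero.1 ((hdeg _ 0 fun j => (Finset.sum_le_sum fun a' _ => hfac _ j a').trans
      ?_).trans (by simp))
    refine (Finset.sum_eq_zero fun a _ => if_neg fun e => ?_).le
    have := congrArg Fin.val e
    simp at this
    omega

open MvPolynomial in
lemma exists_polynomial_cyclePrefactor {m n r s : ℕ} (hm : Even m) (hn : Even n) (hmn : m ≤ n)
    (hs : 2 * s ≤ m) (k : Fin r → ℕ) (B : Fin n → ℂ) :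
    ∃ Q : MvPolynomial (Fin (r + (n - m) / 2)) ℂ,
      (∀ A, cyclePrefactor m r s k 0 n A B = Q.eval A) ∧
      (∀ a : Fin r, Q.degreeOf (Fin.castAdd _ a) ≤ k a) ∧
      ∀ b : Fin ((n - m) / 2), Q.degreeOf (Fin.natAdd r b) ≤ n := by
  classical
  refine ⟨C (cConst n m r s * En 0 B * (∏ j, B j) ^ s) *
    ((∏ a : Fin r, X (Fin.castAdd _ a) ^ k a) *
      ∏ b : Fin ((n - m) / 2), X (Fin.natAdd r b) ^ (n - 1 - 2 * s - 2 * (b : ℕ))),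
    fun A => ?_, fun a => ?_, fun b => ?_⟩
  -- The integer exponent `n - 1 - 2s - 2b` is at least `m - 2s + 1 > 0`, so nothing is lost by
  -- truncated subtraction.
  · have hb : ∀ b : Fin ((n - m) / 2), A (Fin.natAdd r b) ^
        ((n : ℤ) + 1 - 2 * s + 2 * r - 2 * ((r : ℤ) + ((b : ℕ) : ℤ) + 1)) =
        A (Fin.natAdd r b) ^ (n - 1 - 2 * s - 2 * (b : ℕ)) := fun b => by
      rw [← zpow_natCast]
      congr 1
      have := b.2
      obtain ⟨m', rfl⟩ := hm
      obtain ⟨n', rfl⟩ := hn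
      omega
    simp only [cyclePrefactor, map_mul, eval_C, map_prod, map_pow, eval_X, mul_assoc, hb]
  · refine (degreeOf_C_mul_le _ _ _).trans ((degreeOf_mul_le _ _ _).trans ?_)
    have h1 := (degreeOf_prod_le (Fin.castAdd ((n - m) / 2) a) Finset.univ fun a : Fin r =>
      (X (Fin.castAdd ((n - m) / 2) a) ^ k a : MvPolynomial (Fin (r + (n - m) / 2)) ℂ)).trans
      (Finset.sum_le_sum (g := fun a' => if a' = a then k a else 0) fun a' _ => by
        refine (degreeOf_pow_le _ _ _).trans ?_
        rw [degreeOf_X]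
        simp only [Fin.castAdd_inj, eq_comm (a := a)]
        split_ifs with e <;> simp [e])
    have h2 := (degreeOf_prod_le (Fin.castAdd ((n - m) / 2) a) Finset.univ
      fun b : Fin ((n - m) / 2) => (X (Fin.natAdd r b) ^ (n - 1 - 2 * s - 2 * (b : ℕ)) :
        MvPolynomial (Fin (r + (n - m) / 2)) ℂ)).trans
      (Finset.sum_le_sum (g := fun _ => 0) fun b _ => by
        refine (degreeOf_pow_le _ _ _).trans ?_
        rw [degreeOf_X, if_neg, mul_zero]
        intro e
        have := congrArg Fin.val e
        simp at this
        omega)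
    simp at h1 h2
    omega
  · refine (degreeOf_C_mul_le _ _ _).trans ((degreeOf_mul_le _ _ _).trans ?_)
    have h1 := (degreeOf_prod_le (Fin.natAdd r b) Finset.univ fun a : Fin r =>
      (X (Fin.castAdd ((n - m) / 2) a) ^ k a : MvPolynomial (Fin (r + (n - m) / 2)) ℂ)).trans
      (Finset.sum_le_sum (g := fun _ => 0) fun a' _ => by
        refine (degreeOf_pow_le _ _ _).trans ?_
        rw [degreeOf_X, if_neg, mul_zero]
        intro e
        have := congrArg Fin.val e
        simp at this
        omega)
    have h2 := (degreeOf_prod_le (Fin.natAdd r b) Finset.univ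
      fun b : Fin ((n - m) / 2) => (X (Fin.natAdd r b) ^ (n - 1 - 2 * s - 2 * (b : ℕ)) :
        MvPolynomial (Fin (r + (n - m) / 2)) ℂ)).trans
      (Finset.sum_le_sum (g := fun b' => if b' = b then n else 0) fun b' _ => by
        refine (degreeOf_pow_le _ _ _).trans ?_
        rw [degreeOf_X]
        simp only [Fin.natAdd_inj, eq_comm (a := b)]
        split_ifs <;> omega)
    simp at h1 h2
    omega

open MvPolynomial in
lemma wellDefined_detCycle {m s : ℕ} (hm : Even m) (hs : 2 * s ≤ m) (ε : ℤˣ) {r : ℕ}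
    (hr : 2 * r ≤ m) (k : Fin r → ℕ) (hk : ∀ a, k a ≤ m) :
    WellDefined (detCycle ε m r s k 0) := by
  refine wellDefined_of_polynomial fun n hn B => ?_
  rcases lt_or_ge n m with hnm | hnm
  · exact ⟨0, by simp [detCycle, hnm], by simp, by simp⟩
  obtain ⟨Q₁, h₁, h₁', h₁''⟩ := exists_polynomial_cyclePrefactor hm hn hnm hs k B
  obtain ⟨Q₂, h₂, h₂', h₂''⟩ := exists_polynomial_Ddet (r := r) (q := (n - m) / 2) ε m B
  obtain ⟨m', rfl⟩ := hm
  obtain ⟨n', rfl⟩ := hn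
  refine ⟨Q₁ * Q₂, fun A => ?_, fun _ => by omega, fun a => (degreeOf_mul_le _ _ _).trans ?_⟩
  · rw [detCycle, if_neg (not_lt.2 hnm), h₁, h₂, map_mul]
  -- For `a ≤ r` the degrees are at most `k_a ≤ m` and `n - m`, which together just fit the bound
  -- `n`.
  · induction a using Fin.addCases with
    | left a =>
      have e1 := h₁' a
      have e2 := h₂' a
      have e3 := hk a
      omega
    | right b =>
      have e1 := h₁'' b
      have e2 := h₂'' b
      omega

open MvPolynomial in
lemma wellDefined_expCycle {m s : ℕ} (hm : Even m) (hs : 2 * s ≤ m) :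
    WellDefined (expCycle m s 0) := by
  refine wellDefined_of_polynomial (ℓ := fun n => 0 + (n - m) / 2) fun n hn B => ?_
  rcases lt_or_ge n m with hnm | hnm
  · exact ⟨0, by simp [expCycle, hnm], by simp, by simp⟩
  obtain ⟨Q₁, h₁, h₁', h₁''⟩ := exists_polynomial_cyclePrefactor (r := 0) hm hn hnm hs ![] B
  obtain ⟨m', rfl⟩ := hm
  obtain ⟨n', rfl⟩ := hn
  refine ⟨Q₁ * C (Dexp (m' + m') 0 B), fun A => ?_, fun _ => by omega,
    fun a => (degreeOf_mul_C_le _ _ _).trans ?_⟩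
  · rw [expCycle, if_neg (not_lt.2 hnm), h₁, map_mul, eval_C]
  · induction a using Fin.addCases with
    | left a => exact a.elim0
    | right b => exact h₁'' b

/-! Translations -/

/-- A translated connecting path ends at `iy' + θ`, off the imaginary axis in general. A segment in
a half plane beyond the strip containing the translated curve joins it to `iy`. -/
lemma IsContour.shift {n : ℕ} {β : Fin n → ℂ} {γ : ℝ → ℂ} (h : IsContour β γ) (θ : ℂ) :
    IsContour (fun j => β j + θ) (fun t => γ t + θ) := by
  obtain ⟨Y, -, hY⟩ := h.horizontalEnds.exists_strip
  have hY' : ∀ t, -Y < (γ t).im ∧ (γ t).im < Y := fun t => abs_lt.1 (hY t)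
  have hmap : ∀ {p q : ℂ}, JoinedIn (Set.range γ)ᶜ p q →
      JoinedIn (Set.range fun t => γ t + θ)ᶜ (p + θ) (q + θ) := fun {p q} hpq => by
    refine (hpq.map (f := fun z => z + θ) (by fun_prop)).mono ?_
    rintro _ ⟨z, hz, rfl⟩ ⟨t, ht⟩
    exact hz ⟨t, add_right_cancel ht⟩
  refine ⟨h.contDiff.add contDiff_const, fun s t hst => h.injective (add_right_cancel hst), ?_, ?_,
    fun j k => ?_, fun j k => ?_⟩
  · obtain ⟨c, hc⟩ := h.right_end
    exact ⟨c + θ, by filter_upwards [hc] with t ht; rw [ht, add_assoc]⟩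
  · obtain ⟨c, hc⟩ := h.left_end
    exact ⟨c + θ, by filter_upwards [hc] with t ht; rw [ht, add_assoc]⟩
  · obtain ⟨y', hy', hyY⟩ := ((h.above j k).and (eventually_gt_atTop Y)).exists
    filter_upwards [eventually_gt_atTop (Y + θ.im)] with y hy
    have h1 := hmap hy'
    rw [show β j - Real.pi * I + 2 * Real.pi * I * k + θ =
      β j + θ - Real.pi * I + 2 * Real.pi * I * k by ring] at h1
    refine h1.trans (JoinedIn.of_segment_subset
      (((convex_halfSpace_im_gt (Y + θ.im)).segment_subset ?_ ?_).trans ?_))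
    · simpa using hyY
    · simpa using hy
    · rintro _ hz ⟨t, rfl⟩
      have h2 : Y + θ.im < (γ t + θ).im := hz
      have := (hY' t).2
      rw [add_im] at h2
      linarith
  · obtain ⟨y', hy', hyY⟩ := ((h.below j k).and (eventually_lt_atBot (-Y))).exists
    filter_upwards [eventually_lt_atBot (-Y + θ.im)] with y hy
    have h1 := hmap hy'
    rw [show β j - 2 * Real.pi * I * k + θ = β j + θ - 2 * Real.pi * I * k by ring] at h1
    refine h1.trans (JoinedIn.of_segment_subset
      (((convex_halfSpace_im_lt (-Y + θ.im)).segment_subset ?_ ?_).trans ?_))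
    · have : ((y' : ℂ) * I + θ).im < -Y + θ.im := by simp; linarith
      exact this
    · simpa using hy
    · rintro _ hz ⟨t, rfl⟩
      have h2 : (γ t + θ).im < -Y + θ.im := hz
      have := (hY' t).1
      rw [add_im] at h2
      linarith

lemma expNeg_shift {n : ℕ} (β : Fin n → ℂ) (θ : ℂ) :
    expNeg (fun j => β j + θ) = fun j => exp (-θ) * expNeg β j := by
  funext j
  rw [expNeg, expNeg, ← exp_add]
  congr 1; ring

/-- `P` is homogeneous of degree `-w`. -/
def IsHomogeneousCycle {n ℓ : ℕ} (P : (Fin ℓ → ℂ) → (Fin n → ℂ) → ℂ) (w : ℂ) : Prop :=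
  ∀ (θ : ℂ) (A : Fin ℓ → ℂ) (B : Fin n → ℂ),
    P (fun a => exp (-θ) * A a) (fun j => exp (-θ) * B j) = exp (θ * w) * P A B

lemma integrand_shift {n ℓ : ℕ} {P : (Fin ℓ → ℂ) → (Fin n → ℂ) → ℂ} {w : ℂ}
    (hP : IsHomogeneousCycle P w) (β : Fin n → ℂ) (M : Finset (Fin n)) (hM : M.card = ℓ)
    (α : Fin ℓ → ℂ) (θ : ℂ) :
    integrand P (fun j => β j + θ) M hM (fun a => α a + θ) =
      exp (θ * w) * integrand P β M hM α := by
  have h1 : ∀ a j, exp (-θ) * expNeg α a * (exp (-θ) * expNeg β j)⁻¹ =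
      expNeg α a * (expNeg β j)⁻¹ := fun a j => by
    have := exp_ne_zero (-θ)
    field_simp
  simp only [integrand, phi, wM, asym, gM, cycleFn, add_sub_add_right_eq_sub, expNeg_shift, h1]
  rw [hP θ]
  ring

lemma formFactorAlong_shift {n ℓ : ℕ} {P : (Fin ℓ → ℂ) → (Fin n → ℂ) → ℂ} {w : ℂ}
    (hP : IsHomogeneousCycle P w) (β : Fin n → ℂ) (γ : ℝ → ℂ) (θ : ℂ) :
    formFactorAlong P (fun j => β j + θ) (fun t => γ t + θ) =
      exp (θ * ((n : ℂ) ^ 2 / 4 + w)) • formFactorAlong P β γ := by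
  have h1 : ∀ (M : Finset (Fin n)) (hM : M.card = ℓ),
      ∫ t, pullback (fun t => γ t + θ) (integrand P (fun j => β j + θ) M hM) t =
      exp (θ * w) * ∫ t, pullback γ (integrand P β M hM) t := fun M hM => by
    rw [← integral_const_mul]
    refine integral_congr_ae (Eventually.of_forall fun t => ?_)
    simp only [pullback, integrand_shift hP, deriv_add_const]
    ring
  have h2 : PsiAlong P (fun j => β j + θ) (fun t => γ t + θ) =
      exp (θ * w) • PsiAlong P β γ := by
    simp only [PsiAlong, h1, Finset.smul_sum, mul_smul]
  have h3 : exp ((n : ℂ) / 4 * ∑ j, (β j + θ)) =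
      exp (θ * ((n : ℂ) ^ 2 / 4)) * exp ((n : ℂ) / 4 * ∑ j, β j) := by
    rw [← exp_add, Finset.sum_add_distrib]
    congr 1
    simp
    ring
  rw [formFactorAlong, formFactorAlong, h2, smul_smul, smul_smul, h3, mul_add, exp_add]
  simp only [add_sub_add_right_eq_sub]
  congr 1
  ring

lemma shift_mem_regularPoints {n : ℕ} {β : Fin n → ℂ} (hβ : β ∈ regularPoints n) (θ : ℂ) :
    (fun j => β j + θ) ∈ regularPoints n := fun i j p => by
  simpa using hβ i j p

lemma hasSpin_of_isHomogeneousCycle {ℓ : ℕ → ℕ}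
    {P : ∀ n : ℕ, (Fin (ℓ n) → ℂ) → (Fin n → ℂ) → ℂ} {S : ℂ} (hwd : WellDefined P)
    (hP : ∀ n, Even n → IsHomogeneousCycle (P n) (S - (n : ℂ) ^ 2 / 4)) :
    HasSpin (fun n β => formFactor (P n) β) S := by
  intro n hn β hβ θ
  by_cases hγ : ∃ γ : ℝ → ℂ, IsContour β γ
  · obtain ⟨γ, hγ⟩ := hγ
    simp only
    rw [(hwd n hn β hβ γ hγ).2, (hwd n hn _ (shift_mem_regularPoints hβ θ) _ (hγ.shift θ)).2,
      formFactorAlong_shift (hP n hn), add_sub_cancel]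
  -- Without a contour for `β` there is none for the translate either, and both form factors have
  -- the default value 0.
  · have hγ' : ¬ ∃ γ : ℝ → ℂ, IsContour (fun j => β j + θ) γ := fun ⟨γ, h⟩ =>
      hγ ⟨_, by simpa using h.shift (-θ)⟩
    simp only [formFactor, dif_neg hγ, dif_neg hγ', smul_zero]

/-! Degrees of the cycles -/

lemma exp_neg_mul_zpow (θ x : ℂ) (e : ℤ) : (exp (-θ) * x) ^ e = exp (-θ * e) * x ^ e := by
  rw [mul_zpow, ← exp_int_mul, mul_comm (e : ℂ)]

lemma exp_neg_mul_pow (θ x : ℂ) (e : ℕ) : (exp (-θ) * x) ^ e = exp (-θ * e) * x ^ e := by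
  rw [mul_pow, ← exp_nat_mul, mul_comm (e : ℂ)]

lemma sum_range_two_mul (N : ℕ) : ∑ i ∈ Finset.range N, (2 * (i : ℂ)) = N * (N - 1) := by
  induction N with
  | zero => simp
  | succ N ih => rw [Finset.sum_range_succ, ih]; push_cast; ring

lemma sum_range_odd (N : ℕ) : ∑ i ∈ Finset.range N, (2 * (i : ℂ) + 1) = N ^ 2 := by
  induction N with
  | zero => simp
  | succ N ih => rw [Finset.sum_range_succ, ih]; push_cast; ring

lemma sum_card_Ioi (n : ℕ) : ∑ j : Fin n, ((Finset.Ioi j).card : ℂ) = n * (n - 1) / 2 := by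
  have h1 : ∑ j : Fin n, (Finset.Ioi j).card = ∑ i ∈ Finset.range n, i := by
    simp only [Fin.card_Ioi]
    rw [Fin.sum_univ_eq_sum_range (fun i => n - 1 - i), Finset.sum_range_reflect (fun i => i)]
  rw [← Nat.cast_sum, h1, Nat.cast_sum, eq_div_iff two_ne_zero, ← sum_range_two_mul,
    Finset.sum_mul]
  exact Finset.sum_congr rfl fun i _ => mul_comm _ _

lemma Hp_zero {r : ℕ} (ε : ℤˣ) (A : Fin r → ℂ) (p : ℕ) (b : ℂ) :
    Hp ε 0 A p b = b ^ ((ε : ℤ) * (2 * (p : ℤ) - 1)) * ∏ a, (1 - A a ^ 2 * b ^ (-2 : ℤ)) := by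
  simp [Hp]

/-- With `h = (n+m)/2` and `q = (n-m)/2`, the rows have total degree `ε(h(h-1) + q²)` and the
Vandermonde product has degree `εn(n-1)/2`. In the difference `q` drops out. -/
lemma Ddet_smul {r m h q : ℕ} (hm : h = q + m) (ε : ℤˣ) (θ : ℂ) (A : Fin r → ℂ)
    (B : Fin (h + q) → ℂ) :
    Ddet ε m 0 (fun a => exp (-θ) * A a) (fun j => exp (-θ) * B j) =
      exp (-θ * (((ε : ℤ) : ℂ) * ((m : ℂ) * ((m : ℂ) - 1) / 2))) * Ddet ε m 0 A B := by
  have hh : (h + q + m) / 2 = h := by omega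
  set w : ℕ → ℤ := fun i => if i < h then 2 * (i : ℤ) else 2 * ((i - h + 1 : ℕ) : ℤ) - 1 with hw
  have h1 : ∀ i j : Fin (h + q),
      (if (i : ℕ) < (h + q + m) / 2 then (exp (-θ) * B j) ^ ((ε : ℤ) * (2 * ((i : ℕ) : ℤ)))
        else Hp ε 0 (fun a => exp (-θ) * A a) ((i : ℕ) - (h + q + m) / 2 + 1) (exp (-θ) * B j)) =
      exp (-θ * ((ε : ℤ) * w i : ℤ)) *
      (if (i : ℕ) < (h + q + m) / 2 then B j ^ ((ε : ℤ) * (2 * ((i : ℕ) : ℤ)))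
        else Hp ε 0 A ((i : ℕ) - (h + q + m) / 2 + 1) (B j)) := fun i j => by
    rw [hh]
    simp only [hw]
    split_ifs
    · rw [exp_neg_mul_zpow]
    · have h2 : ∀ a, (exp (-θ) * A a) ^ 2 * (exp (-θ) * B j) ^ (-2 : ℤ) =
          A a ^ 2 * B j ^ (-2 : ℤ) := fun a => by
        rw [exp_neg_mul_zpow, exp_neg_mul_pow]
        have : exp (-θ * (2 : ℕ)) * exp (-θ * (-2 : ℤ)) = 1 := by
          rw [← exp_add, ← exp_zero]; congr 1; push_cast; ring
        linear_combination (A a ^ 2 * B j ^ (-2 : ℤ)) * this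
      simp only [Hp_zero, h2]
      rw [exp_neg_mul_zpow]
      ring
  have h2 : ∀ j j' : Fin (h + q), (exp (-θ) * B j) ^ (ε : ℤ) - (exp (-θ) * B j') ^ (ε : ℤ) =
      exp (-θ * (ε : ℤ)) * (B j ^ (ε : ℤ) - B j' ^ (ε : ℤ)) := fun j j' => by
    rw [exp_neg_mul_zpow, exp_neg_mul_zpow]; ring
  have h3 : ∏ i : Fin (h + q), exp (-θ * ((ε : ℤ) * w i : ℤ)) =
      exp (-θ * ((ε : ℤ) * ((h : ℂ) * (h - 1) + q ^ 2))) := by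
    rw [← exp_sum, ← Finset.mul_sum]
    congr 2
    push_cast
    rw [← Finset.mul_sum, Fin.sum_univ_eq_sum_range (fun i => (w i : ℂ)), Finset.sum_range_add]
    congr 2
    · rw [← sum_range_two_mul]
      refine Finset.sum_congr rfl fun i hi => ?_
      rw [hw]
      simp only [if_pos (Finset.mem_range.1 hi)]
      push_cast; ring
    · rw [← sum_range_odd]
      refine Finset.sum_congr rfl fun i _ => ?_
      rw [hw]
      simp only [if_neg (show ¬ h + i < h by omega), Nat.add_sub_cancel_left]
      push_cast; ring
  have h4 : ∏ j : Fin (h + q), ∏ _j' ∈ Finset.Ioi j, exp (-θ * (ε : ℤ)) =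
      exp (-θ * ((ε : ℤ) * (((h + q : ℕ) : ℂ) * (((h + q : ℕ) : ℂ) - 1) / 2))) := by
    rw [← sum_card_Ioi, Finset.mul_sum, Finset.mul_sum, exp_sum]
    refine Finset.prod_congr rfl fun j _ => ?_
    rw [Finset.prod_const, ← exp_nat_mul]
    congr 1; ring
  rw [Ddet, Ddet]
  simp only [h1, h2, Finset.prod_mul_distrib]
  have h5 := Matrix.det_mul_column (fun i : Fin (h + q) => exp (-θ * ((ε : ℤ) * w i : ℤ)))
    (Matrix.of fun i j : Fin (h + q) =>
      if (i : ℕ) < (h + q + m) / 2 then B j ^ ((ε : ℤ) * (2 * ((i : ℕ) : ℤ)))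
      else Hp ε 0 A ((i : ℕ) - (h + q + m) / 2 + 1) (B j))
  simp only [Matrix.of_apply] at h5
  rw [h4, h5, h3, mul_div_mul_comm, ← exp_sub]
  congr 2
  subst hm
  push_cast
  ring

/-- The last `q` variables contribute `q(n - 1 - 2s) - q(q - 1) = q(n - q) - 2qs`. Here `q(n - q) =
(n² - m²)/4`, and `-2qs` turns the `ns` from the `B_j` into `ms`. -/
lemma cyclePrefactor_smul {m n r s q : ℕ} (hq : n = m + 2 * q) (k : Fin r → ℕ) (θ : ℂ)
    (A : Fin (r + (n - m) / 2) → ℂ) (B : Fin n → ℂ) :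
    cyclePrefactor m r s k 0 n (fun a => exp (-θ) * A a) (fun j => exp (-θ) * B j) =
      exp (-θ * ((m : ℂ) * s + ∑ a, (k a : ℂ) + ((n : ℂ) ^ 2 - (m : ℂ) ^ 2) / 4)) *
        cyclePrefactor m r s k 0 n A B := by
  have hE : ∀ B : Fin n → ℂ, En 0 B = 1 := fun B => by simp [En]
  have hqn : (n - m) / 2 = q := by omega
  have h1 : ∏ b : Fin ((n - m) / 2), exp (-θ *
      (((n : ℤ) + 1 - 2 * s + 2 * r - 2 * ((r : ℤ) + ((b : ℕ) : ℤ) + 1) : ℤ) : ℂ)) =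
      exp (-θ * (q * ((n : ℂ) - 1 - 2 * s) - q * (q - 1))) := by
    rw [← exp_sum, ← Finset.mul_sum, ← sum_range_two_mul, Fin.sum_univ_eq_sum_range (fun b =>
      (((n : ℤ) + 1 - 2 * s + 2 * r - 2 * ((r : ℤ) + (b : ℤ) + 1) : ℤ) : ℂ)), hqn]
    have h2 : (q : ℂ) * ((n : ℂ) - 1 - 2 * s) =
        ∑ _b ∈ Finset.range q, ((n : ℂ) - 1 - 2 * s) := by
      rw [Finset.sum_const, Finset.card_range, nsmul_eq_mul]
    rw [h2, ← Finset.sum_sub_distrib]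
    congr 2
    refine Finset.sum_congr rfl fun b _ => ?_
    push_cast; ring
  have h2 : ∏ a, exp (-θ * (k a : ℂ)) = exp (-θ * ∑ a, (k a : ℂ)) := by
    rw [← exp_sum, Finset.mul_sum]
  simp only [cyclePrefactor, hE, exp_neg_mul_zpow, exp_neg_mul_pow, Finset.prod_mul_distrib,
    Finset.prod_const, Finset.card_univ, Fintype.card_fin, h1, h2]
  rw [mul_pow, ← exp_nat_mul, ← exp_nat_mul]
  have h3 : exp (-θ * ((m : ℂ) * s + ∑ a, (k a : ℂ) + ((n : ℂ) ^ 2 - (m : ℂ) ^ 2) / 4)) =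
      exp (s * (n * -θ)) * exp (-θ * ∑ a, (k a : ℂ)) *
      exp (-θ * (q * ((n : ℂ) - 1 - 2 * s) - q * (q - 1))) := by
    rw [← exp_add, ← exp_add]
    congr 1
    subst hq
    push_cast
    ring
  rw [h3]
  ring

lemma exists_eq_add_two_mul {m n : ℕ} (hm : Even m) (hn : Even n) (h : m ≤ n) :
    ∃ q, n = m + 2 * q := by
  obtain ⟨m', rfl⟩ := hm
  obtain ⟨n', rfl⟩ := hn
  exact ⟨n' - m', by omega⟩

lemma isHomogeneousCycle_detCycle {m n r : ℕ} (hm : Even m) (hn : Even n) (ε : ℤˣ) (s : ℕ)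
    (k : Fin r → ℕ) :
    IsHomogeneousCycle (detCycle ε m r s k 0 n) (-(∑ a, (k a : ℂ)) + (m : ℂ) ^ 2 / 4 - (m : ℂ) * s
      - ((ε : ℤ) : ℂ) * ((m : ℂ) * ((m : ℂ) - 1) / 2) - (n : ℂ) ^ 2 / 4) := by
  intro θ A B
  rcases lt_or_ge n m with hnm | hnm
  · simp [detCycle, hnm]
  obtain ⟨q, hq⟩ := exists_eq_add_two_mul hm hn hnm
  have h1 : Ddet ε m 0 (fun a : Fin r => exp (-θ) * A (Fin.castAdd _ a))
      (fun j => exp (-θ) * B j) = exp (-θ * (((ε : ℤ) : ℂ) * ((m : ℂ) * ((m : ℂ) - 1) / 2))) *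
      Ddet ε m 0 (fun a : Fin r => A (Fin.castAdd _ a)) B := by
    obtain rfl : n = (q + m) + q := by omega
    exact Ddet_smul rfl ε θ _ B
  simp only [detCycle, if_neg (not_lt.2 hnm)]
  rw [cyclePrefactor_smul hq, h1, mul_mul_mul_comm, ← exp_add]
  congr 2
  ring

lemma isHomogeneousCycle_expCycle {m n : ℕ} (hm : Even m) (hn : Even n) (s : ℕ) :
    IsHomogeneousCycle (expCycle m s 0 n) ((m : ℂ) ^ 2 / 4 - (m : ℂ) * s - (n : ℂ) ^ 2 / 4) := by
  intro θ A B
  rcases lt_or_ge n m with hnm | hnm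
  · simp [expCycle, hnm]
  obtain ⟨q, hq⟩ := exists_eq_add_two_mul hm hn hnm
  have h1 : ∀ B : Fin n → ℂ, Dexp m 0 B = (-1) ^ ((n - m) * (n - m + 2) / 8) := fun B => by
    simp [Dexp]
  simp only [expCycle, if_neg (not_lt.2 hnm), h1]
  rw [cyclePrefactor_smul hq, mul_assoc]
  congr 2
  simp
  ring

end SU2Thirring

end

theorem mainTheorem6 (m s : ℕ) (hm : Even m) (hs : 2 * s ≤ m) :
    (∀ (ε : ℤˣ) (r : ℕ) (_ : 2 * r ≤ m) (k : Fin r → ℕ) (_ : ∀ a, k a ≤ m),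
      SU2Thirring.WellDefined (SU2Thirring.detCycle ε m r s k 0) ∧
      SU2Thirring.HasSpin
        (fun n β => SU2Thirring.formFactor (SU2Thirring.detCycle ε m r s k 0 n) β)
        (-(∑ a, (k a : ℂ)) + (m : ℂ) ^ 2 / 4 - (m : ℂ) * s
          - ((ε : ℤ) : ℂ) * ((m : ℂ) * ((m : ℂ) - 1) / 2))) ∧
    (SU2Thirring.WellDefined (SU2Thirring.expCycle m s 0) ∧
      SU2Thirring.HasSpin
        (fun n β => SU2Thirring.formFactor (SU2Thirring.expCycle m s 0 n) β)
        ((m : ℂ) ^ 2 / 4 - (m : ℂ) * s)) := by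
  refine ⟨fun ε r hr k hk => ?_, ?_⟩
  · have h := SU2Thirring.wellDefined_detCycle hm hs ε hr k hk
    exact ⟨h, SU2Thirring.hasSpin_of_isHomogeneousCycle h fun n hn =>
      SU2Thirring.isHomogeneousCycle_detCycle hm hn ε s k⟩
  · have h := SU2Thirring.wellDefined_expCycle hm hs
    exact ⟨h, SU2Thirring.hasSpin_of_isHomogeneousCycle
      (ℓ := fun n => 0 + (n - m) / 2) h fun n hn =>
      SU2Thirring.isHomogeneousCycle_expCycle hm hn s⟩
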